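/- Let $K_0\subset K\subset\mathbb R^n$, where $K_0$ is a linear subspace, $K$ is a closed convex cone and $K_0\neq K$. For a nonempty closed convex set $C\subset\mathbb R^n$ let $\Pi_C(x)=\arg\min_{y\in C}\|x-y\|^2$ be the metric projection for the Euclidean norm. Let $\xi$ be a standard Gaussian vector in $\mathbb R^n$, let $\delta_C=\mathbb E\|\Pi_C(\xi)\|^2$ denote the statistical dimension of a closed convex cone $C$, and set $$T(y)=\|y-\Pi_{K_0}(y)\|^2-\|y-\Pi_K(y)\|^2,\qquad m_0=\mathbb E\,T(\xi),\qquad \sigma_0=\sqrt{\operatorname{Var}(T(\xi))}.$$ Then $\delta_K-\delta_{K_0}>0$ and $\sigma_0>0$, and for every $\mu\in K_0$ the observation $Y=\mu+\xi$ satisfies $$d_{\mathrm{TV}}\left(\frac{T(Y)-m_0}{\sigma_0},\,\mathcal N(0,1)\right)\le\frac{8}{\sqrt{\delta_K-\delta_{K_0}}},$$ where $d_{\mathrm{TV}}(X,Z)=\sup_{B}|\mathbb P(X\in B)-\mathbb P(Z\in B)|$, the supremum being over all Borel sets $B\subset\mathbb R$. -/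

import Mathlib

open MeasureTheory ProbabilityTheory

noncomputable section

/-- Euclidean space `ℝⁿ` with the `ℓ²` norm. -/
abbrev RVec (n : ℕ) : Type := EuclideanSpace ℝ (Fin n)

/-- The metric projection of `x` onto `K`: the point of `K` minimizing `‖x - y‖ ^ 2` over `y ∈ K`.
For `K` nonempty, closed and convex such a point exists and is unique. -/
def metricProj {n : ℕ} (K : Set (RVec n)) (x : RVec n) : RVec n :=
  Classical.epsilon fun y => y ∈ K ∧ ∀ z ∈ K, ‖x - y‖ ^ 2 ≤ ‖x - z‖ ^ 2

/-- The statistical dimension `δ_K = 𝔼 ‖Π_K(ξ)‖ ^ 2`, with `ξ` standard Gaussian in `ℝⁿ`. -/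
def statDim {n : ℕ} (K : Set (RVec n)) : ℝ :=
  ∫ x, ‖metricProj K x‖ ^ 2 ∂(stdGaussian (RVec n))

/-- The likelihood ratio statistic `T(y) = ‖y - Π_{K₀}(y)‖ ^ 2 - ‖y - Π_K(y)‖ ^ 2`. -/
def lrtStat {n : ℕ} (K₀ K : Set (RVec n)) (y : RVec n) : ℝ :=
  ‖y - metricProj K₀ y‖ ^ 2 - ‖y - metricProj K y‖ ^ 2

/-- The mean `m_μ` of `T(μ + ξ)`, with `ξ` standard Gaussian. -/
def lrtMean {n : ℕ} (K₀ K : Set (RVec n)) (μ : RVec n) : ℝ :=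
  ∫ x, lrtStat K₀ K (μ + x) ∂(stdGaussian (RVec n))

/-- The standard deviation `σ_μ` of `T(μ + ξ)`, with `ξ` standard Gaussian. -/
def lrtSD {n : ℕ} (K₀ K : Set (RVec n)) (μ : RVec n) : ℝ :=
  √(variance (fun x => lrtStat K₀ K (μ + x)) (stdGaussian (RVec n)))

/-- The total variation distance between two probability measures on `ℝ`:
the supremum of `|P(B) - Q(B)|` over all Borel sets `B`. -/
def tvDist (P Q : Measure ℝ) : ℝ :=
  ⨆ B : {B : Set ℝ // MeasurableSet B}, |P.real B.1 - Q.real B.1|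

end

/-! Put `Φ = Π_K - Π_{K₀}`, which is `residualProj`. Moreau's decomposition and Pythagoras give `T =
‖Φ‖²`, `δ = δ_K - δ_{K₀} = 𝔼‖Φ(ξ)‖²` and invariance of `Φ` under translation by `K₀`, so `μ` plays
no role. The analysis then uses only the two relations in `IsConicProj`; they make `Φ` firmly
nonexpansive and `‖Φ‖²` differentiable with gradient `2Φ`.

The normal approximation is Stein's method with an explicit kernel. Rotate an independent Gaussian
pair `(x, y)` by `x_θ = cos θ x + sin θ y`. Differentiating `𝔼 G(x) F(x_θ)` and integrating by parts
gives `Cov(G, F) = ∫ sin θ 𝔼⟪∇G(x), ∇F(x_θ)⟫ dθ` over `[0, π/2]` (`gaussian_covariance_formula`).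
For `F = ‖Φ‖²` and `G = h(F)` this becomes `𝔼 (F - δ) h(F) = 𝔼 h'(F) Γ`, where `Γ = 4⟪Φ, Q⟫` and `Q
= circleAvg Φ` (`integral_mul_comp_norm_sq`).

Three estimates finish the proof. The solution of Stein's equation for a test function with values
in `[0, 1]` has derivative at most 2 (`exists_stein_solution`), so with `v = Var F = 𝔼 Γ` the
distance is at most `(2 / v) 𝔼|Γ - v|`. The cone inequality gives `Γ ≥ 2‖Φ‖²`, hence `v ≥ 2δ`.
Finally `Φ` is 1-Lipschitz and `Q` is 1/2-Lipschitz, so a Gaussian Poincaré inequality gives `Var Γ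
≤ 64δ` and `𝔼|Γ - v| ≤ 8√δ`. Together these yield `2 · 8√δ / (2δ) = 8 / √δ`. -/

noncomputable section

/-! ### Rotations of an independent Gaussian pair -/

section Gaussian

open scoped RealInnerProductSpace

/-- A function of polynomial growth is integrable with respect to a Gaussian measure. -/
lemma integrable_of_norm_le_pow {W H : Type*} [NormedAddCommGroup W] [NormedSpace ℝ W]
    [MeasurableSpace W] [BorelSpace W] [CompleteSpace W] [SecondCountableTopology W]
    [NormedAddCommGroup H] (ν : Measure W) [IsGaussian ν] {φ : W → H}
    (hφ : AEStronglyMeasurable φ ν) (C : ℝ) (k : ℕ) (h : ∀ w, ‖φ w‖ ≤ C * (1 + ‖w‖) ^ k) :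
    Integrable φ ν := by
  have h1 : MemLp (fun w : W => 1 + ‖w‖) k ν :=
    (memLp_const (1 : ℝ)).add (MemLp.norm (IsGaussian.memLp_id ν k (by simp)))
  have h2 : Integrable (fun w : W => (1 + ‖w‖) ^ k) ν := by
    have := h1.integrable_norm_pow'
    refine this.congr (ae_of_all _ fun w => ?_)
    simp only [Real.norm_eq_abs]
    rw [abs_of_nonneg (by positivity)]
  exact (h2.const_mul C).mono' hφ (ae_of_all _ h)

section Circle

variable {E : Type*} [NormedAddCommGroup E] [InnerProductSpace ℝ E]

/-- The position at angle `θ` on the quarter circle joining `x` to `y`. -/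
def circlePt (θ : ℝ) (p : E × E) : E := Real.cos θ • p.1 + Real.sin θ • p.2

/-- The velocity at angle `θ` on the quarter circle joining `x` to `y`. -/
def circleVel (θ : ℝ) (p : E × E) : E := -Real.sin θ • p.1 + Real.cos θ • p.2

@[fun_prop]
lemma continuous_circlePt : Continuous fun q : ℝ × (E × E) => circlePt q.1 q.2 := by
  unfold circlePt; fun_prop

@[fun_prop]
lemma continuous_circleVel : Continuous fun q : ℝ × (E × E) => circleVel q.1 q.2 := by
  unfold circleVel; fun_prop

@[fun_prop]
lemma continuous_circlePt_right (θ : ℝ) : Continuous fun p : E × E => circlePt θ p := by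
  unfold circlePt; fun_prop

@[fun_prop]
lemma continuous_circleVel_right (θ : ℝ) : Continuous fun p : E × E => circleVel θ p := by
  unfold circleVel; fun_prop

@[fun_prop]
lemma continuous_circlePt_left (p : E × E) : Continuous fun θ : ℝ => circlePt θ p := by
  unfold circlePt; fun_prop

@[fun_prop]
lemma continuous_circlePt_pair (x : E) :
    Continuous fun q : ℝ × E => circlePt q.1 (x, q.2) := by
  unfold circlePt; fun_prop

@[fun_prop]
lemma continuous_circlePt_triple :
    Continuous fun q : E × (ℝ × E) => circlePt q.2.1 (q.1, q.2.2) := by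
  unfold circlePt; fun_prop

lemma norm_circlePt_le (θ : ℝ) (p : E × E) : ‖circlePt θ p‖ ≤ ‖p.1‖ + ‖p.2‖ := by
  unfold circlePt
  refine (norm_add_le _ _).trans ?_
  rw [norm_smul, norm_smul]
  have h1 := mul_le_of_le_one_left (norm_nonneg p.1) (Real.abs_cos_le_one θ)
  have h2 := mul_le_of_le_one_left (norm_nonneg p.2) (Real.abs_sin_le_one θ)
  exact add_le_add h1 h2

lemma norm_circleVel_le (θ : ℝ) (p : E × E) : ‖circleVel θ p‖ ≤ ‖p.1‖ + ‖p.2‖ := by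
  unfold circleVel
  refine (norm_add_le _ _).trans ?_
  rw [norm_smul, norm_smul, norm_neg]
  have h1 := mul_le_of_le_one_left (norm_nonneg p.1) (Real.abs_sin_le_one θ)
  have h2 := mul_le_of_le_one_left (norm_nonneg p.2) (Real.abs_cos_le_one θ)
  exact add_le_add h1 h2

lemma norm_fst_add_norm_snd_le {E : Type*} [NormedAddCommGroup E] (p : E × E) :
    ‖p.1‖ + ‖p.2‖ ≤ 2 * ‖p‖ := by
  linarith [norm_fst_le p, norm_snd_le p]

lemma one_add_norm_circlePt_le (θ : ℝ) (p : E × E) : 1 + ‖circlePt θ p‖ ≤ 2 * (1 + ‖p‖) := by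
  linarith [norm_circlePt_le θ p, norm_fst_add_norm_snd_le p, norm_nonneg p]

lemma norm_circleVel_le' (θ : ℝ) (p : E × E) : ‖circleVel θ p‖ ≤ 2 * (1 + ‖p‖) := by
  linarith [norm_circleVel_le θ p, norm_fst_add_norm_snd_le p, norm_nonneg p]

lemma hasDerivAt_circlePt (θ : ℝ) (p : E × E) :
    HasDerivAt (fun θ => circlePt θ p) (circleVel θ p) θ := by
  unfold circlePt circleVel
  exact ((Real.hasDerivAt_cos θ).smul_const p.1).add ((Real.hasDerivAt_sin θ).smul_const p.2)

lemma circlePt_zero (p : E × E) : circlePt 0 p = p.1 := by simp [circlePt]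
lemma circleVel_zero (p : E × E) : circleVel 0 p = p.2 := by simp [circleVel]
lemma circlePt_pi_div_two (p : E × E) : circlePt (Real.pi / 2) p = p.2 := by simp [circlePt]

/-- Inverse rotation: it makes an integrand a function of position and velocity, which are again
independent standard Gaussians. -/
lemma fst_eq_rotate (θ : ℝ) (p : E × E) :
    p.1 = Real.cos θ • circlePt θ p - Real.sin θ • circleVel θ p := by
  have h := Real.cos_sq_add_sin_sq θ
  unfold circlePt circleVel
  have : p.1 = (Real.cos θ ^ 2 + Real.sin θ ^ 2) • p.1 := by rw [h, one_smul]
  nth_rewrite 1 [this]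
  module

lemma snd_eq_rotate (θ : ℝ) (p : E × E) :
    p.2 = Real.sin θ • circlePt θ p + Real.cos θ • circleVel θ p := by
  have h := Real.cos_sq_add_sin_sq θ
  unfold circlePt circleVel
  have : p.2 = (Real.cos θ ^ 2 + Real.sin θ ^ 2) • p.2 := by rw [h, one_smul]
  nth_rewrite 1 [this]
  module

lemma one_add_norm_sub_le (θ : ℝ) (u v : E) :
    1 + ‖Real.cos θ • u - Real.sin θ • v‖ ≤ (1 + ‖u‖) * (1 + ‖v‖) := by
  have h := norm_sub_le (Real.cos θ • u) (Real.sin θ • v)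
  rw [norm_smul, norm_smul] at h
  have h1 := mul_le_of_le_one_left (norm_nonneg u) (Real.abs_cos_le_one θ)
  have h2 := mul_le_of_le_one_left (norm_nonneg v) (Real.abs_sin_le_one θ)
  simp only [Real.norm_eq_abs] at h
  nlinarith [mul_nonneg (norm_nonneg u) (norm_nonneg v)]

end Circle

variable {E : Type*} [NormedAddCommGroup E] [InnerProductSpace ℝ E] [FiniteDimensional ℝ E]
  [MeasurableSpace E] [BorelSpace E]

/-- Rotation invariance of a pair of independent standard Gaussian vectors. -/
lemma measurePreserving_rotate (θ : ℝ) :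
    MeasurePreserving (fun p : E × E => (circlePt θ p, circleVel θ p))
      ((stdGaussian E).prod (stdGaussian E)) ((stdGaussian E).prod (stdGaussian E)) := by
  refine ⟨by fun_prop, ?_⟩
  exact IsGaussian.map_rotation_eq_self (μ := stdGaussian E)
    (by simp) θ

lemma measurePreserving_circlePt (θ : ℝ) :
    MeasurePreserving (fun p : E × E => circlePt θ p)
      ((stdGaussian E).prod (stdGaussian E)) (stdGaussian E) :=
  measurePreserving_fst.comp (measurePreserving_rotate θ)

lemma integral_rotate {H : Type*} [NormedAddCommGroup H] [NormedSpace ℝ H] (θ : ℝ)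
    {φ : E × E → H} (hφ : Continuous φ) :
    ∫ p, φ (circlePt θ p, circleVel θ p) ∂((stdGaussian E).prod (stdGaussian E))
      = ∫ p, φ p ∂((stdGaussian E).prod (stdGaussian E)) := by
  have h := measurePreserving_rotate (E := E) θ
  conv_rhs => rw [← h.map_eq]
  exact (integral_map h.measurable.aemeasurable hφ.aestronglyMeasurable).symm

lemma integral_inner_mul_inner (a b : E) :
    ∫ y, ⟪b, y⟫ * ⟪a, y⟫ ∂(stdGaussian E) = ⟪b, a⟫ := by
  have h := covarianceBilin_apply (μ := stdGaussian E) IsGaussian.memLp_two_id b a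
  rw [covarianceBilin_stdGaussian] at h
  simp only [integral_id_stdGaussian, id, sub_zero] at h
  exact h.symm

/-- Differentiation of Gaussian averages along rotations. -/
lemma hasDerivAt_integral_circlePt {F : E → ℝ} {f : E → E} {w : E × E → ℝ} {C : ℝ} {k : ℕ}
    (hF : ∀ x, HasGradientAt F (f x) x) (hf : Continuous f) (hw : Continuous w)
    (hFb : ∀ x, ‖F x‖ ≤ C * (1 + ‖x‖) ^ k) (hfb : ∀ x, ‖f x‖ ≤ C * (1 + ‖x‖) ^ k)
    (hwb : ∀ p, ‖w p‖ ≤ C * (1 + ‖p‖) ^ k) (θ : ℝ) :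
    HasDerivAt
      (fun θ => ∫ p, w p * F (circlePt θ p) ∂((stdGaussian E).prod (stdGaussian E)))
      (∫ p, w p * ⟪f (circlePt θ p), circleVel θ p⟫ ∂((stdGaussian E).prod (stdGaussian E)))
      θ := by
  have hC : 0 ≤ C := by simpa using (norm_nonneg _).trans (hFb 0)
  have hFc : Continuous F := continuous_iff_continuousAt.2 fun x => (hF x).continuousAt
  have hpt : ∀ θ (p : E × E), (1 + ‖circlePt θ p‖) ^ k ≤ 2 ^ k * (1 + ‖p‖) ^ k := fun θ p => by
    rw [← mul_pow]
    exact pow_le_pow_left₀ (by positivity) (one_add_norm_circlePt_le θ p) k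
  have hb : ∀ θ (p : E × E), ‖w p * ⟪f (circlePt θ p), circleVel θ p⟫‖ ≤
      C * C * 2 ^ k * 2 * (1 + ‖p‖) ^ (k + k + 1) := fun θ p => by
    rw [norm_mul]
    calc ‖w p‖ * ‖⟪f (circlePt θ p), circleVel θ p⟫‖
        ≤ (C * (1 + ‖p‖) ^ k) * (C * (2 ^ k * (1 + ‖p‖) ^ k) * (2 * (1 + ‖p‖))) := by
          gcongr
          · exact hwb p
          · refine (norm_inner_le_norm _ _).trans ?_
            gcongr
            · exact (hfb _).trans (by gcongr; exact hpt θ p)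
            · exact norm_circleVel_le' θ p
      _ = _ := by ring
  refine (hasDerivAt_integral_of_dominated_loc_of_deriv_le (s := Set.univ)
    (bound := fun p => C * C * 2 ^ k * 2 * (1 + ‖p‖) ^ (k + k + 1)) Filter.univ_mem
    (Filter.Eventually.of_forall fun θ => ?_) ?_ ?_ (ae_of_all _ fun p θ _ => hb θ p) ?_
    (ae_of_all _ fun p θ _ => ?_)).2
  · exact Continuous.aestronglyMeasurable (by fun_prop)
  · refine integrable_of_norm_le_pow _ (Continuous.aestronglyMeasurable (by fun_prop))
      (C * C * 2 ^ k) (k + k) fun p => ?_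
    rw [norm_mul]
    calc ‖w p‖ * ‖F (circlePt θ p)‖
        ≤ (C * (1 + ‖p‖) ^ k) * (C * (2 ^ k * (1 + ‖p‖) ^ k)) := by
          gcongr
          · exact hwb p
          · exact (hFb _).trans (by gcongr; exact hpt θ p)
      _ = _ := by ring
  · exact Continuous.aestronglyMeasurable (by fun_prop)
  · refine integrable_of_norm_le_pow _ (Continuous.aestronglyMeasurable (by fun_prop))
      (C * C * 2 ^ k * 2) (k + k + 1) fun p => ?_
    rw [Real.norm_of_nonneg (by positivity)]
  · have := (hF (circlePt θ p)).hasFDerivAt.comp_hasDerivAt θ (hasDerivAt_circlePt θ p)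
    simpa using this.const_mul (w p)

end Gaussian

/-! ### Gaussian integration by parts and the covariance formula -/

section GaussianCovariance

open scoped RealInnerProductSpace

variable {E : Type*} [NormedAddCommGroup E] [InnerProductSpace ℝ E] [FiniteDimensional ℝ E]
  [MeasurableSpace E] [BorelSpace E]

lemma integral_inner_stdGaussian (a : E) : ∫ y, ⟪a, y⟫ ∂(stdGaussian E) = 0 := by
  simpa using integral_strongDual_stdGaussian (innerSL ℝ a)

/-- Gaussian integration by parts. -/
lemma integral_mul_inner_stdGaussian {G : E → ℝ} {g : E → E} {C : ℝ} {k : ℕ}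
    (hG : ∀ x, HasGradientAt G (g x) x) (hg : Continuous g)
    (hGb : ∀ x, ‖G x‖ ≤ C * (1 + ‖x‖) ^ k) (hgb : ∀ x, ‖g x‖ ≤ C * (1 + ‖x‖) ^ k) (a : E) :
    ∫ x, G x * ⟪a, x⟫ ∂(stdGaussian E) = ∫ x, ⟪g x, a⟫ ∂(stdGaussian E) := by
  have hC : 0 ≤ C := by simpa using (norm_nonneg _).trans (hGb 0)
  have hGc : Continuous G := continuous_iff_continuousAt.2 fun x => (hG x).continuousAt
  -- A single growth bound must also cover the linear weight `⟪a, y⟫`, hence `C + ‖a‖` and the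
  -- exponent `k + 1`.
  have hup : ∀ r : ℝ, 0 ≤ r → C * (1 + r) ^ k ≤ (C + ‖a‖) * (1 + r) ^ (k + 1) := fun r hr => by
    gcongr <;> linarith [norm_nonneg a]
  have hw : ∀ p : E × E, ‖⟪a, p.2⟫‖ ≤ ‖a‖ * (1 + ‖p‖) := fun p =>
    (norm_inner_le_norm _ _).trans (by gcongr; linarith [norm_snd_le p])
  have hd := hasDerivAt_integral_circlePt (w := fun p => ⟪a, p.2⟫) (C := C + ‖a‖) (k := k + 1)
    hG hg (by fun_prop) (fun x => (hGb x).trans (hup _ (norm_nonneg x)))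
    (fun x => (hgb x).trans (hup _ (norm_nonneg x)))
    (fun p => (hw p).trans (by
      have h1 : (1 : ℝ) ≤ 1 + ‖p‖ := by linarith [norm_nonneg p]
      calc ‖a‖ * (1 + ‖p‖) = ‖a‖ * (1 + ‖p‖) ^ 1 := by ring
        _ ≤ (C + ‖a‖) * (1 + ‖p‖) ^ (k + 1) := by gcongr <;> linarith)) 0
  have hint : Integrable (fun x => G x * ⟪a, x⟫) (stdGaussian E) := by
    refine integrable_of_norm_le_pow _ (Continuous.aestronglyMeasurable (by fun_prop))
      (C * ‖a‖) (k + 1) fun x => ?_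
    rw [norm_mul]
    calc ‖G x‖ * ‖⟪a, x⟫‖ ≤ (C * (1 + ‖x‖) ^ k) * (‖a‖ * (1 + ‖x‖)) := by
          gcongr
          · exact hGb x
          · exact (norm_inner_le_norm _ _).trans (by gcongr; linarith)
      _ = _ := by ring
  have hGi : Integrable G (stdGaussian E) :=
    integrable_of_norm_le_pow _ hGc.aestronglyMeasurable C k hGb
  have hai : Integrable (fun x => ⟪a, x⟫) (stdGaussian E) :=
    IsGaussian.integrable_id.const_inner a
  -- Undoing the rotation, only the component of `y` along the position correlates with `G`, leaving
  -- a multiple of `sin θ`. Comparing its derivative at 0 with `hd` is the integration by parts.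
  have hfun : (fun θ => ∫ p, ⟪a, p.2⟫ * G (circlePt θ p) ∂((stdGaussian E).prod (stdGaussian E)))
      = fun θ => Real.sin θ * ∫ x, G x * ⟪a, x⟫ ∂(stdGaussian E) := by
    funext θ
    have h1 := integral_rotate (E := E) θ
      (φ := fun q => ⟪a, Real.sin θ • q.1 + Real.cos θ • q.2⟫ * G q.1) (by fun_prop)
    simp only [← snd_eq_rotate] at h1
    rw [h1]
    have h2 : ∀ q : E × E, ⟪a, Real.sin θ • q.1 + Real.cos θ • q.2⟫ * G q.1
        = Real.sin θ * ((G q.1 * ⟪a, q.1⟫) * 1) + Real.cos θ * (G q.1 * ⟪a, q.2⟫) := fun q => by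
      rw [inner_add_right, real_inner_smul_right, real_inner_smul_right]; ring
    simp only [h2]
    rw [integral_add ((hint.mul_prod (integrable_const (1 : ℝ))).const_mul _)
      ((hGi.mul_prod hai).const_mul _), integral_const_mul, integral_const_mul,
      integral_prod_mul (fun x => G x * ⟪a, x⟫) (fun _ => (1 : ℝ)),
      integral_prod_mul G (fun x => ⟪a, x⟫), integral_inner_stdGaussian]
    simp
  rw [hfun] at hd
  have hd' := (Real.hasDerivAt_sin 0).mul_const (∫ x, G x * ⟪a, x⟫ ∂(stdGaussian E))
  have := hd'.unique hd
  rw [Real.cos_zero, one_mul] at this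
  rw [this]
  simp only [circlePt_zero, circleVel_zero]
  have hi : Integrable (fun p : E × E => ⟪a, p.2⟫ * ⟪g p.1, p.2⟫)
      ((stdGaussian E).prod (stdGaussian E)) := by
    refine integrable_of_norm_le_pow _ (Continuous.aestronglyMeasurable (by fun_prop))
      (‖a‖ * C) (k + 2) fun p => ?_
    rw [norm_mul]
    calc ‖⟪a, p.2⟫‖ * ‖⟪g p.1, p.2⟫‖
        ≤ (‖a‖ * (1 + ‖p‖)) * ((C * (1 + ‖p‖) ^ k) * (1 + ‖p‖)) := by
          gcongr
          · exact hw p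
          · refine (norm_inner_le_norm _ _).trans ?_
            gcongr
            · exact (hgb _).trans (by gcongr; exact norm_fst_le p)
            · linarith [norm_snd_le p]
      _ = _ := by ring
  rw [integral_prod _ hi]
  simp only [integral_inner_mul_inner]
  simp only [real_inner_comm]

/-- In rotated coordinates `x = cos θ u - sin θ v` with `u`, `v` independent. Integrating by parts
in `v` alone, at fixed `u`, produces the factor `-sin θ`. -/
lemma integral_mul_inner_circleVel {G : E → ℝ} {g f : E → E} {C : ℝ} {k : ℕ}
    (hG : ∀ x, HasGradientAt G (g x) x) (hg : Continuous g) (hf : Continuous f)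
    (hGb : ∀ x, ‖G x‖ ≤ C * (1 + ‖x‖) ^ k) (hgb : ∀ x, ‖g x‖ ≤ C * (1 + ‖x‖) ^ k)
    (hfb : ∀ x, ‖f x‖ ≤ C * (1 + ‖x‖) ^ k) (θ : ℝ) :
    ∫ p, G p.1 * ⟪f (circlePt θ p), circleVel θ p⟫ ∂((stdGaussian E).prod (stdGaussian E))
      = -Real.sin θ *
        ∫ p, ⟪g p.1, f (circlePt θ p)⟫ ∂((stdGaussian E).prod (stdGaussian E)) := by
  have hC : 0 ≤ C := by simpa using (norm_nonneg _).trans (hGb 0)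
  have hGc : Continuous G := continuous_iff_continuousAt.2 fun x => (hG x).continuousAt
  have hpow : ∀ u v : E, (1 + ‖Real.cos θ • u - Real.sin θ • v‖) ^ k
      ≤ (1 + ‖u‖) ^ k * (1 + ‖v‖) ^ k := fun u v => by
    rw [← mul_pow]; exact pow_le_pow_left₀ (by positivity) (one_add_norm_sub_le θ u v) k
  have h1 := integral_rotate (E := E) θ
    (φ := fun q => G (Real.cos θ • q.1 - Real.sin θ • q.2) * ⟪f q.1, q.2⟫) (by fun_prop)
  have h2 := integral_rotate (E := E) θ
    (φ := fun q => ⟪g (Real.cos θ • q.1 - Real.sin θ • q.2), f q.1⟫) (by fun_prop)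
  simp only [← fst_eq_rotate] at h1 h2
  rw [h1, h2]
  have hi1 : Integrable
      (fun q : E × E => G (Real.cos θ • q.1 - Real.sin θ • q.2) * ⟪f q.1, q.2⟫)
      ((stdGaussian E).prod (stdGaussian E)) := by
    refine integrable_of_norm_le_pow _ (Continuous.aestronglyMeasurable (by fun_prop))
      (C * C) (k + k + k + 1) fun p => ?_
    rw [norm_mul]
    calc _ ≤ (C * ((1 + ‖p‖) ^ k * (1 + ‖p‖) ^ k)) * ((C * (1 + ‖p‖) ^ k) * (1 + ‖p‖)) := by
          gcongr
          · refine (hGb _).trans ?_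
            gcongr
            refine (hpow _ _).trans ?_
            gcongr
            · exact norm_fst_le p
            · exact norm_snd_le p
          · refine (norm_inner_le_norm _ _).trans ?_
            gcongr
            · exact (hfb _).trans (by gcongr; exact norm_fst_le p)
            · linarith [norm_snd_le p]
      _ = _ := by ring
  have hi2 : Integrable
      (fun q : E × E => ⟪g (Real.cos θ • q.1 - Real.sin θ • q.2), f q.1⟫)
      ((stdGaussian E).prod (stdGaussian E)) := by
    refine integrable_of_norm_le_pow _ (Continuous.aestronglyMeasurable (by fun_prop))
      (C * C) (k + k + k) fun p => ?_
    calc _ ≤ (C * ((1 + ‖p‖) ^ k * (1 + ‖p‖) ^ k)) * (C * (1 + ‖p‖) ^ k) := by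
          refine (norm_inner_le_norm _ _).trans ?_
          gcongr
          · refine (hgb _).trans ?_
            gcongr
            refine (hpow _ _).trans ?_
            gcongr
            · exact norm_fst_le p
            · exact norm_snd_le p
          · exact (hfb _).trans (by gcongr; exact norm_fst_le p)
      _ = _ := by ring
  rw [integral_prod _ hi1, integral_prod _ hi2, ← integral_const_mul]
  congr 1 with u
  have hgrad : ∀ v, HasGradientAt (fun v => G (Real.cos θ • u - Real.sin θ • v))
      (-Real.sin θ • g (Real.cos θ • u - Real.sin θ • v)) v := fun v => by
    have ha : HasFDerivAt (fun v : E => Real.cos θ • u - Real.sin θ • v)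
        (-(Real.sin θ • ContinuousLinearMap.id ℝ E)) v :=
      ((hasFDerivAt_id v).const_smul (Real.sin θ)).const_sub _
    have := (hG (Real.cos θ • u - Real.sin θ • v)).hasFDerivAt.comp v ha
    rw [hasGradientAt_iff_hasFDerivAt]
    refine this.congr_fderiv ?_
    ext z
    simp
  -- The growth constant may depend on the frozen variable `u`.
  have := integral_mul_inner_stdGaussian hgrad (by fun_prop) (C := C * (1 + ‖u‖) ^ k) (k := k)
    (fun v => (hGb _).trans (by
      rw [mul_assoc]; gcongr; exact hpow u v))
    (fun v => by
      rw [norm_smul, norm_neg]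
      refine (mul_le_of_le_one_left (norm_nonneg _) (Real.abs_sin_le_one θ)).trans ?_
      refine (hgb _).trans ?_
      rw [mul_assoc]; gcongr; exact hpow u v) (f u)
  simp only [real_inner_smul_left] at this
  rw [this, integral_const_mul]

/-- Covariance of two functions of a standard Gaussian vector in terms of their gradients. -/
lemma gaussian_covariance_formula {F G : E → ℝ} {f g : E → E} {C : ℝ} {k : ℕ}
    (hF : ∀ x, HasGradientAt F (f x) x) (hf : Continuous f)
    (hG : ∀ x, HasGradientAt G (g x) x) (hg : Continuous g)
    (hFb : ∀ x, ‖F x‖ ≤ C * (1 + ‖x‖) ^ k) (hfb : ∀ x, ‖f x‖ ≤ C * (1 + ‖x‖) ^ k)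
    (hGb : ∀ x, ‖G x‖ ≤ C * (1 + ‖x‖) ^ k) (hgb : ∀ x, ‖g x‖ ≤ C * (1 + ‖x‖) ^ k) :
    ∫ x, G x * F x ∂(stdGaussian E) - (∫ x, G x ∂(stdGaussian E)) * ∫ x, F x ∂(stdGaussian E)
      = ∫ θ in (0 : ℝ)..(Real.pi / 2), Real.sin θ *
        ∫ p, ⟪g p.1, f (circlePt θ p)⟫ ∂((stdGaussian E).prod (stdGaussian E)) := by
  have hC : 0 ≤ C := by simpa using (norm_nonneg _).trans (hGb 0)
  have hFc : Continuous F := continuous_iff_continuousAt.2 fun x => (hF x).continuousAt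
  have hGc : Continuous G := continuous_iff_continuousAt.2 fun x => (hG x).continuousAt
  have hpt : ∀ θ (p : E × E), (1 + ‖circlePt θ p‖) ^ k ≤ 2 ^ k * (1 + ‖p‖) ^ k := fun θ p => by
    rw [← mul_pow]
    exact pow_le_pow_left₀ (by positivity) (one_add_norm_circlePt_le θ p) k
  set ψ : ℝ → ℝ := fun θ =>
    ∫ p, ⟪g p.1, f (circlePt θ p)⟫ ∂((stdGaussian E).prod (stdGaussian E)) with hψ
  have hψc : Continuous ψ := by
    refine continuous_of_dominated (bound := fun p => C * C * 2 ^ k * (1 + ‖p‖) ^ (k + k))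
      (fun θ => Continuous.aestronglyMeasurable (by fun_prop))
      (fun θ => ae_of_all _ fun p => ?_) ?_ (ae_of_all _ fun p => by fun_prop)
    · calc _ ≤ (C * (1 + ‖p‖) ^ k) * (C * (2 ^ k * (1 + ‖p‖) ^ k)) := by
            refine (norm_inner_le_norm _ _).trans ?_
            gcongr
            · exact (hgb _).trans (by gcongr; exact norm_fst_le p)
            · exact (hfb _).trans (by gcongr; exact hpt θ p)
        _ = _ := by ring
    · refine integrable_of_norm_le_pow _ (Continuous.aestronglyMeasurable (by fun_prop))
        (C * C * 2 ^ k) (k + k) fun p => ?_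
      rw [Real.norm_of_nonneg (by positivity)]
  have hd : ∀ θ, HasDerivAt
      (fun θ => ∫ p, G p.1 * F (circlePt θ p) ∂((stdGaussian E).prod (stdGaussian E)))
      (-Real.sin θ * ψ θ) θ := fun θ => by
    rw [hψ, ← integral_mul_inner_circleVel hG hg hf hGb hgb hfb θ]
    exact hasDerivAt_integral_circlePt (w := fun p => G p.1) hF hf (by fun_prop) hFb hfb
      (fun p => (hGb _).trans (by gcongr; exact norm_fst_le p)) θ
  -- The endpoints are `𝔼[GF]` at angle 0, where the two points coincide, and `𝔼 G · 𝔼 F` at angle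
  -- `π / 2`, where they are independent.
  have hFTC := intervalIntegral.integral_eq_sub_of_hasDerivAt (a := 0) (b := Real.pi / 2)
    (fun θ _ => hd θ) (Continuous.intervalIntegrable (by fun_prop) _ _)
  simp only [neg_mul, intervalIntegral.integral_neg, circlePt_zero, circlePt_pi_div_two] at hFTC
  rw [integral_prod_mul G F] at hFTC
  have h0 := integral_prod_mul (μ := stdGaussian E) (ν := stdGaussian E)
    (fun x => G x * F x) (fun _ => (1 : ℝ))
  simp only [mul_one, integral_const, probReal_univ, smul_eq_mul] at h0
  rw [h0] at hFTC
  linarith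

end GaussianCovariance

/-! ### Abstract conic projections and their averages over quarter circles -/

section ConicProjection

open scoped RealInnerProductSpace NNReal

/-- The defining inequalities of the metric projection onto a closed convex cone. -/
structure IsConicProj {E : Type*} [NormedAddCommGroup E] [InnerProductSpace ℝ E]
    (Φ : E → E) : Prop where
  inner_self : ∀ x, ⟪Φ x, x⟫ = ‖Φ x‖ ^ 2
  inner_le : ∀ x y, ⟪Φ x, y⟫ ≤ ⟪Φ x, Φ y⟫

namespace IsConicProj

section Basic

variable {E : Type*} [NormedAddCommGroup E] [InnerProductSpace ℝ E] {Φ : E → E}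

/-- Firm nonexpansiveness: add `inner_le` for `(x, y)` and for `(y, x)`. -/
lemma norm_sub_sq_le (hΦ : IsConicProj Φ) (x y : E) :
    ‖Φ x - Φ y‖ ^ 2 ≤ ⟪Φ x - Φ y, x - y⟫ := by
  rw [norm_sub_sq_real, inner_sub_left, inner_sub_right, inner_sub_right, hΦ.inner_self x,
    hΦ.inner_self y]
  have h1 := hΦ.inner_le x y
  have h2 := hΦ.inner_le y x
  rw [real_inner_comm (Φ x) (Φ y)] at h2
  linarith

lemma norm_sub_le (hΦ : IsConicProj Φ) (x y : E) : ‖Φ x - Φ y‖ ≤ ‖x - y‖ := by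
  have h := (hΦ.norm_sub_sq_le x y).trans (real_inner_le_norm _ _)
  rcases (norm_nonneg (Φ x - Φ y)).eq_or_lt with h0 | h0
  · rw [← h0]; exact norm_nonneg _
  · rw [sq] at h
    exact le_of_mul_le_mul_left h h0

lemma norm_le (hΦ : IsConicProj Φ) (x : E) : ‖Φ x‖ ≤ ‖x‖ := by
  have h := (hΦ.inner_self x).symm.le.trans (real_inner_le_norm _ _)
  rcases (norm_nonneg (Φ x)).eq_or_lt with h0 | h0
  · rw [← h0]; exact norm_nonneg _
  · rw [sq] at h
    exact le_of_mul_le_mul_left h h0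

lemma lipschitzWith (hΦ : IsConicProj Φ) : LipschitzWith 1 Φ :=
  LipschitzWith.of_dist_le_mul fun x y => by
    simpa [dist_eq_norm] using hΦ.norm_sub_le x y

lemma continuous (hΦ : IsConicProj Φ) : Continuous Φ := hΦ.lipschitzWith.continuous

lemma inner_le_norm_sq_sub (hΦ : IsConicProj Φ) (x y : E) :
    2 * ⟪Φ x, y - x⟫ ≤ ‖Φ y‖ ^ 2 - ‖Φ x‖ ^ 2 := by
  rw [inner_sub_right, hΦ.inner_self x]
  have h1 := hΦ.inner_le x y
  have h2 := norm_sub_sq_real (Φ x) (Φ y)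
  nlinarith [sq_nonneg ‖Φ x - Φ y‖]

/-- The preceding subgradient inequality, used in both directions, traps the remainder between 0 and
`2⟪Φ y - Φ x, y - x⟫`. This quadratic bound gives differentiability at every point, although `Φ`
itself need not be differentiable. -/
lemma abs_norm_sq_sub_le (hΦ : IsConicProj Φ) (x y : E) :
    |‖Φ y‖ ^ 2 - ‖Φ x‖ ^ 2 - 2 * ⟪Φ x, y - x⟫| ≤ 2 * ‖y - x‖ ^ 2 := by
  have h1 := hΦ.inner_le_norm_sq_sub x y
  have h2 := hΦ.inner_le_norm_sq_sub y x
  have h3 : ⟪Φ y - Φ x, y - x⟫ ≤ ‖y - x‖ * ‖y - x‖ :=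
    (real_inner_le_norm _ _).trans (by gcongr; exact hΦ.norm_sub_le y x)
  rw [inner_sub_left] at h3
  have h4 : ⟪Φ y, x - y⟫ = -⟪Φ y, y - x⟫ := by rw [← inner_neg_right, neg_sub]
  rw [abs_of_nonneg (by linarith)]
  nlinarith

lemma hasGradientAt [CompleteSpace E] (hΦ : IsConicProj Φ) (x : E) :
    HasGradientAt (fun x => ‖Φ x‖ ^ 2) ((2 : ℝ) • Φ x) x := by
  rw [hasGradientAt_iff_isLittleO]
  have hO : (fun y => ‖Φ y‖ ^ 2 - ‖Φ x‖ ^ 2 - ⟪(2 : ℝ) • Φ x, y - x⟫)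
      =O[nhds x] fun y => ‖y - x‖ ^ 2 :=
    Asymptotics.IsBigO.of_bound 2 (Filter.Eventually.of_forall fun y => by
      rw [real_inner_smul_left]
      simpa using hΦ.abs_norm_sq_sub_le x y)
  refine hO.trans_isLittleO ?_
  have := Asymptotics.isLittleO_pow_sub_sub x (m := 2) (by norm_num)
  exact this

lemma norm_comp_circlePt_le (hΦ : IsConicProj Φ) (θ : ℝ) (p : E × E) :
    ‖Φ (circlePt θ p)‖ ≤ ‖p.1‖ + ‖p.2‖ :=
  (hΦ.norm_le _).trans (norm_circlePt_le θ p)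

lemma continuous_comp_circlePt (hΦ : IsConicProj Φ) (x : E) :
    Continuous fun q : ℝ × E => Φ (circlePt q.1 (x, q.2)) :=
  hΦ.continuous.comp (continuous_circlePt_pair x)

end Basic

end IsConicProj

/-- The probability measure with density `sin θ` on `(0, π / 2]`. -/
def sinMeasure : Measure ℝ :=
  (volume.restrict (Set.Ioc 0 (Real.pi / 2))).withDensity fun θ => ENNReal.ofReal (Real.sin θ)

lemma sin_nonneg_of_mem_Ioc {θ : ℝ} (h : θ ∈ Set.Ioc 0 (Real.pi / 2)) : 0 ≤ Real.sin θ :=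
  Real.sin_nonneg_of_nonneg_of_le_pi h.1.le (by linarith [h.2, Real.pi_pos])

lemma integral_sinMeasure (ψ : ℝ → ℝ) :
    ∫ θ, ψ θ ∂sinMeasure = ∫ θ in (0 : ℝ)..(Real.pi / 2), Real.sin θ * ψ θ := by
  rw [sinMeasure, integral_withDensity_eq_integral_toReal_smul (by fun_prop) (by simp),
    intervalIntegral.integral_of_le (by positivity)]
  refine setIntegral_congr_fun measurableSet_Ioc fun θ hθ => ?_
  simp [ENNReal.toReal_ofReal (sin_nonneg_of_mem_Ioc hθ)]

instance : IsProbabilityMeasure sinMeasure := ⟨by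
  rw [sinMeasure, withDensity_apply _ MeasurableSet.univ, Measure.restrict_univ,
    ← ofReal_integral_eq_lintegral_ofReal]
  · rw [← intervalIntegral.integral_of_le (by positivity), integral_sin]
    simp
  · exact (Real.continuous_sin.intervalIntegrable 0 (Real.pi / 2)).1
  · exact (ae_restrict_iff' measurableSet_Ioc).2 (ae_of_all _ fun θ hθ =>
      sin_nonneg_of_mem_Ioc hθ)⟩

lemma integral_cos_sinMeasure : ∫ θ, Real.cos θ ∂sinMeasure = 1 / 2 := by
  rw [integral_sinMeasure, integral_sin_mul_cos₁]
  simp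

lemma integral_abs_cos_sinMeasure : ∫ θ, |Real.cos θ| ∂sinMeasure = 1 / 2 := by
  rw [← integral_cos_sinMeasure, integral_sinMeasure, integral_sinMeasure]
  refine intervalIntegral.integral_congr fun θ hθ => ?_
  rw [Set.uIcc_of_le (by positivity)] at hθ
  rw [abs_of_nonneg (Real.cos_nonneg_of_neg_pi_div_two_le_of_le
    (by linarith [hθ.1, Real.pi_pos]) hθ.2)]

variable {E : Type*} [NormedAddCommGroup E] [InnerProductSpace ℝ E] [FiniteDimensional ℝ E]
  [MeasurableSpace E] [BorelSpace E] {Φ : E → E}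

/-- Fubini, to turn the angular integral in the covariance formula into an average conditional on
the starting point `x`. -/
lemma integral_integral_circlePt {K : ℝ → E × E → ℝ}
    (hK : Continuous fun q : ℝ × (E × E) => K q.1 q.2) {b : E × E → ℝ}
    (hb : Integrable b ((stdGaussian E).prod (stdGaussian E))) (hKb : ∀ θ p, ‖K θ p‖ ≤ b p) :
    ∫ x, ∫ q, K q.1 (x, q.2) ∂(sinMeasure.prod (stdGaussian E)) ∂(stdGaussian E)
      = ∫ θ, ∫ p, K θ p ∂((stdGaussian E).prod (stdGaussian E)) ∂sinMeasure := by
  have hint : Integrable (fun q : ℝ × (E × E) => K q.1 q.2)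
      (sinMeasure.prod ((stdGaussian E).prod (stdGaussian E))) :=
    (hb.comp_snd sinMeasure).mono' hK.aestronglyMeasurable (ae_of_all _ fun q => hKb _ _)
  have hint' := hint.integral_prod_right
  rw [integral_integral_swap hint, integral_prod _ hint']
  have hbx := hb.prod_right_ae
  refine integral_congr_ae ?_
  filter_upwards [hbx] with x hx
  have : Integrable (fun q : ℝ × E => K q.1 (x, q.2)) (sinMeasure.prod (stdGaussian E)) :=
    (hx.comp_snd sinMeasure).mono'
      (Continuous.aestronglyMeasurable (hK.comp (by fun_prop : Continuous fun q : ℝ × E =>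
        (q.1, (x, q.2))))) (ae_of_all _ fun q => hKb _ _)
  rw [integral_prod_symm _ this]

/-- The average of `Φ` along quarter circles starting at `x` and ending at a standard
Gaussian vector. -/
def circleAvg (Φ : E → E) (x : E) : E :=
  ∫ q, Φ (circlePt q.1 (x, q.2)) ∂(sinMeasure.prod (stdGaussian E))

namespace IsConicProj

lemma integrable_norm_stdGaussian : Integrable (fun y : E => ‖y‖) (stdGaussian E) :=
  (IsGaussian.integrable_id (μ := stdGaussian E)).norm

lemma integrable_comp_circlePt (hΦ : IsConicProj Φ) (x : E) :
    Integrable (fun q : ℝ × E => Φ (circlePt q.1 (x, q.2))) (sinMeasure.prod (stdGaussian E)) :=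
  (((integrable_const ‖x‖).add integrable_norm_stdGaussian).comp_snd sinMeasure).mono'
    (hΦ.continuous_comp_circlePt x).aestronglyMeasurable
    (ae_of_all _ fun q => hΦ.norm_comp_circlePt_le q.1 (x, q.2))

/-- At angle `θ` the integrand is `|cos θ|`-Lipschitz in `x`, and the mean of `|cos θ|` under
`sinMeasure` is 1/2. -/
lemma circleAvg_lipschitzWith (hΦ : IsConicProj Φ) :
    LipschitzWith (1 / 2) (circleAvg Φ) := by
  refine LipschitzWith.of_dist_le_mul fun x y => ?_
  rw [dist_eq_norm, dist_eq_norm, circleAvg, circleAvg,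
    ← integral_sub (hΦ.integrable_comp_circlePt x) (hΦ.integrable_comp_circlePt y)]
  have h1 : ∫ q : ℝ × E, |Real.cos q.1| * ‖x - y‖ ∂(sinMeasure.prod (stdGaussian E))
      = 1 / 2 * ‖x - y‖ := by
    rw [integral_prod_mul (fun θ => |Real.cos θ|) (fun _ : E => ‖x - y‖),
      integral_abs_cos_sinMeasure]
    simp
  have hc : Integrable (fun θ => |Real.cos θ|) sinMeasure :=
    (integrable_const (1 : ℝ)).mono' (Continuous.aestronglyMeasurable (by fun_prop))
      (ae_of_all _ fun θ => by simpa using Real.abs_cos_le_one θ)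
  have h2 := norm_integral_le_of_norm_le (hc.mul_prod (integrable_const (μ := stdGaussian E)
      ‖x - y‖)) (f := fun q : ℝ × E => Φ (circlePt q.1 (x, q.2)) - Φ (circlePt q.1 (y, q.2)))
    (ae_of_all _ fun q => by
      refine (hΦ.norm_sub_le _ _).trans (le_of_eq ?_)
      simp only [circlePt]
      rw [add_sub_add_right_eq_sub, ← smul_sub, norm_smul, Real.norm_eq_abs])
  rw [h1] at h2
  simpa using h2

lemma continuous_circleAvg (hΦ : IsConicProj Φ) : Continuous (circleAvg Φ) :=
  hΦ.circleAvg_lipschitzWith.continuous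

lemma norm_circleAvg_le (hΦ : IsConicProj Φ) :
    ∃ C, ∀ x, ‖circleAvg Φ x‖ ≤ C * (1 + ‖x‖) := by
  refine ⟨1 + ‖circleAvg Φ 0‖, fun x => ?_⟩
  have h := hΦ.circleAvg_lipschitzWith.dist_le_mul x 0
  rw [dist_eq_norm, dist_zero_right] at h
  have h2 := norm_le_norm_add_norm_sub' (circleAvg Φ x) (circleAvg Φ 0)
  have h3 : ((1 / 2 : ℝ≥0) : ℝ) = 1 / 2 := by norm_num
  rw [h3] at h
  nlinarith [norm_nonneg x, norm_nonneg (circleAvg Φ 0),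
    mul_nonneg (norm_nonneg x) (norm_nonneg (circleAvg Φ 0))]

lemma inner_circleAvg (hΦ : IsConicProj Φ) (a x : E) :
    ⟪a, circleAvg Φ x⟫
      = ∫ q, ⟪a, Φ (circlePt q.1 (x, q.2))⟫ ∂(sinMeasure.prod (stdGaussian E)) :=
  (integral_inner (hΦ.integrable_comp_circlePt x) a).symm

lemma integrable_sq_stdGaussian : Integrable (fun y : E => ‖y‖ ^ 2) (stdGaussian E) :=
  (IsGaussian.memLp_two_id (μ := stdGaussian E)).integrable_norm_pow (by norm_num)

lemma integrable_norm_sq (hΦ : IsConicProj Φ) :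
    Integrable (fun x => ‖Φ x‖ ^ 2) (stdGaussian E) :=
  integrable_sq_stdGaussian.mono' ((hΦ.continuous.norm.pow 2).aestronglyMeasurable)
    (ae_of_all _ fun x => by
      rw [Real.norm_of_nonneg (by positivity)]
      gcongr
      exact hΦ.norm_le x)

lemma integrable_norm_circleAvg_sq (hΦ : IsConicProj Φ) :
    Integrable (fun x => ‖circleAvg Φ x‖ ^ 2) (stdGaussian E) := by
  obtain ⟨C, hC⟩ := hΦ.norm_circleAvg_le
  refine integrable_of_norm_le_pow _ ((hΦ.continuous_circleAvg.norm.pow 2).aestronglyMeasurable)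
    (C ^ 2) 2 fun x => ?_
  rw [Real.norm_of_nonneg (by positivity), ← mul_pow]
  exact pow_le_pow_left₀ (norm_nonneg _) (hC x) 2

lemma integrable_add_norm_sq :
    Integrable (fun p : E × E => (‖p.1‖ + ‖p.2‖) ^ 2)
      ((stdGaussian E).prod (stdGaussian E)) := by
  refine integrable_of_norm_le_pow _ (Continuous.aestronglyMeasurable (by fun_prop)) (2 ^ 2) 2
    fun p => ?_
  rw [Real.norm_of_nonneg (by positivity), ← mul_pow]
  exact pow_le_pow_left₀ (by positivity)
    (by linarith [norm_fst_add_norm_snd_le p]) 2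

/-- Average `⟪Φ x, x_θ⟫ ≤ ⟪Φ x, Φ x_θ⟫`: the `sin θ` term has mean zero in `y`, and the mean of `cos
θ` is 1/2. This bounds the Stein kernel below. -/
lemma half_norm_sq_le_inner_circleAvg (hΦ : IsConicProj Φ) (x : E) :
    ‖Φ x‖ ^ 2 / 2 ≤ ⟪Φ x, circleAvg Φ x⟫ := by
  have hlin : Integrable (fun q : ℝ × E => ⟪Φ x, circlePt q.1 (x, q.2)⟫)
      (sinMeasure.prod (stdGaussian E)) := by
    refine Integrable.const_inner (Φ x) ?_
    refine (((integrable_const ‖x‖).add integrable_norm_stdGaussian).comp_snd sinMeasure).mono'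
      (continuous_circlePt_pair x).aestronglyMeasurable
      (ae_of_all _ fun q => norm_circlePt_le q.1 (x, q.2))
  have h1 : ∫ q : ℝ × E, ⟪Φ x, circlePt q.1 (x, q.2)⟫ ∂(sinMeasure.prod (stdGaussian E))
      = ‖Φ x‖ ^ 2 / 2 := by
    rw [integral_prod _ hlin]
    have h2 : ∀ θ : ℝ, ∫ y, ⟪Φ x, circlePt θ (x, y)⟫ ∂(stdGaussian E)
        = ‖Φ x‖ ^ 2 * Real.cos θ := fun θ => by
      simp only [circlePt, inner_add_right, real_inner_smul_right]
      rw [integral_add (integrable_const _)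
        ((IsGaussian.integrable_id.const_inner (Φ x)).const_mul _), integral_const_mul,
        integral_const_mul, integral_inner_stdGaussian, hΦ.inner_self]
      simp [mul_comm]
    simp only [h2]
    rw [integral_const_mul, integral_cos_sinMeasure]
    ring
  rw [← h1, hΦ.inner_circleAvg]
  exact integral_mono hlin ((hΦ.integrable_comp_circlePt x).const_inner (Φ x))
    fun q => hΦ.inner_le _ _

lemma norm_circleAvg_sq_le (hΦ : IsConicProj Φ) (x : E) :
    ‖circleAvg Φ x‖ ^ 2
      ≤ ∫ q, ‖Φ (circlePt q.1 (x, q.2))‖ ^ 2 ∂(sinMeasure.prod (stdGaussian E)) := by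
  have hm : MemLp (fun q : ℝ × E => ‖Φ (circlePt q.1 (x, q.2))‖) 2
      (sinMeasure.prod (stdGaussian E)) := by
    have hb : MemLp (fun y : E => ‖x‖ + ‖y‖) 2 (stdGaussian E) :=
      (memLp_const ‖x‖).add (MemLp.norm IsGaussian.memLp_two_id)
    exact (hb.comp_snd sinMeasure).mono'
      (hΦ.continuous_comp_circlePt x).norm.aestronglyMeasurable
      (ae_of_all _ fun q => by
        simpa using hΦ.norm_comp_circlePt_le q.1 (x, q.2))
  have h1 := variance_nonneg (fun q : ℝ × E => ‖Φ (circlePt q.1 (x, q.2))‖)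
    (sinMeasure.prod (stdGaussian E))
  rw [variance_eq_sub hm] at h1
  have h2 : ‖circleAvg Φ x‖ ≤ _ := norm_integral_le_integral_norm _
  have h3 := pow_le_pow_left₀ (norm_nonneg _) h2 2
  simp only [Pi.pow_apply] at h1
  linarith

/-- Jensen pointwise in `x`, then rotation invariance: `x_θ` is standard Gaussian for every `θ`. -/
lemma integral_norm_circleAvg_sq_le (hΦ : IsConicProj Φ) :
    ∫ x, ‖circleAvg Φ x‖ ^ 2 ∂(stdGaussian E) ≤ ∫ x, ‖Φ x‖ ^ 2 ∂(stdGaussian E) := by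
  have hK : Continuous fun q : ℝ × (E × E) => ‖Φ (circlePt q.1 q.2)‖ ^ 2 :=
    (hΦ.continuous.comp continuous_circlePt).norm.pow 2
  have hb : ∀ θ (p : E × E), ‖‖Φ (circlePt θ p)‖ ^ 2‖ ≤ (‖p.1‖ + ‖p.2‖) ^ 2 := fun θ p => by
    rw [Real.norm_of_nonneg (by positivity)]
    exact pow_le_pow_left₀ (norm_nonneg _) (hΦ.norm_comp_circlePt_le θ p) 2
  have h1 := integral_integral_circlePt (K := fun θ p => ‖Φ (circlePt θ p)‖ ^ 2) hK
    integrable_add_norm_sq hb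
  have h2 : ∀ θ : ℝ, ∫ p, ‖Φ (circlePt θ p)‖ ^ 2 ∂((stdGaussian E).prod (stdGaussian E))
      = ∫ x, ‖Φ x‖ ^ 2 ∂(stdGaussian E) := fun θ => by
    have h := measurePreserving_circlePt (E := E) θ
    conv_rhs => rw [← h.map_eq]
    exact (integral_map h.measurable.aemeasurable
      (hΦ.continuous.norm.pow 2).aestronglyMeasurable).symm
  simp only [h2, integral_const, probReal_univ, one_smul] at h1
  rw [← h1]
  have hint : Integrable (fun q : E × (ℝ × E) => ‖Φ (circlePt q.2.1 (q.1, q.2.2))‖ ^ 2)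
      ((stdGaussian E).prod (sinMeasure.prod (stdGaussian E))) := by
    have hnn : Integrable (fun q : E × (ℝ × E) => 2 * (‖q.1‖ ^ 2 * 1) + 2 * (1 * ‖q.2.2‖ ^ 2))
        ((stdGaussian E).prod (sinMeasure.prod (stdGaussian E))) :=
      ((integrable_sq_stdGaussian.mul_prod (integrable_const (1 : ℝ))).const_mul 2).add
        (((integrable_const (1 : ℝ)).mul_prod
          (integrable_sq_stdGaussian.comp_snd sinMeasure)).const_mul 2)
    refine hnn.mono' (Continuous.aestronglyMeasurable ?_) (ae_of_all _ fun q => ?_)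
    · exact (hΦ.continuous.comp continuous_circlePt_triple).norm.pow 2
    · refine (hb q.2.1 (q.1, q.2.2)).trans ?_
      simp only
      nlinarith [sq_nonneg (‖q.1‖ - ‖q.2.2‖)]
  exact integral_mono hΦ.integrable_norm_circleAvg_sq hint.integral_prod_left
    fun x => hΦ.norm_circleAvg_sq_le x

/-- Integration by parts for functions of `‖Φ‖ ^ 2` under the standard Gaussian measure. -/
lemma integral_mul_comp_norm_sq (hΦ : IsConicProj Φ) {h h' : ℝ → ℝ} {M : ℝ}
    (hh : ∀ t, HasDerivAt h (h' t) t) (hc : Continuous h') (hM : ∀ t, |h' t| ≤ M) :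
    ∫ x, (‖Φ x‖ ^ 2 - ∫ z, ‖Φ z‖ ^ 2 ∂(stdGaussian E)) * h (‖Φ x‖ ^ 2) ∂(stdGaussian E)
      = ∫ x, h' (‖Φ x‖ ^ 2) * (4 * ⟪Φ x, circleAvg Φ x⟫) ∂(stdGaussian E) := by
  have hcΦ := hΦ.continuous
  have hM0 : 0 ≤ M := (abs_nonneg _).trans (hM 0)
  have hhc : Continuous h := continuous_iff_continuousAt.2 fun t => (hh t).continuousAt
  have hlin : ∀ t, |h t| ≤ |h 0| + M * |t| := fun t => by
    have := Convex.norm_image_sub_le_of_norm_hasDerivWithin_le (s := Set.univ) (C := M)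
      (fun x _ => (hh x).hasDerivWithinAt) (fun x _ => hM x) convex_univ
      (Set.mem_univ 0) (Set.mem_univ t)
    simp only [Real.norm_eq_abs, sub_zero] at this
    have h2 := abs_sub_abs_le_abs_sub (h t) (h 0)
    linarith
  -- One constant serving the growth bounds of `‖Φ‖²`, `h(‖Φ‖²)` and both gradients.
  set C : ℝ := 2 + |h 0| + 2 * M with hCdef
  have hC1 : 2 ≤ C := by have := abs_nonneg (h 0); linarith
  have hsq : ∀ x : E, ‖x‖ ^ 2 ≤ (1 + ‖x‖) ^ 2 := fun x => by gcongr; linarith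
  have hone : ∀ x : E, ‖x‖ ≤ (1 + ‖x‖) ^ 2 := fun x => by nlinarith [norm_nonneg x]
  have hone' : ∀ x : E, 1 ≤ (1 + ‖x‖) ^ 2 := fun x => by nlinarith [norm_nonneg x]
  have hF2 : ∀ x, ‖Φ x‖ ^ 2 ≤ (1 + ‖x‖) ^ 2 := fun x =>
    (pow_le_pow_left₀ (norm_nonneg _) (hΦ.norm_le x) 2).trans (hsq x)
  have hFb : ∀ x, ‖‖Φ x‖ ^ 2‖ ≤ C * (1 + ‖x‖) ^ 2 := fun x => by
    rw [Real.norm_of_nonneg (by positivity)]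
    nlinarith [hF2 x, hone' x]
  have hfb : ∀ x, ‖(2 : ℝ) • Φ x‖ ≤ C * (1 + ‖x‖) ^ 2 := fun x => by
    rw [norm_smul, Real.norm_of_nonneg (by norm_num)]
    nlinarith [hΦ.norm_le x, hone x, hone' x]
  have hGb : ∀ x, ‖h (‖Φ x‖ ^ 2)‖ ≤ C * (1 + ‖x‖) ^ 2 := fun x => by
    have h1 := hlin (‖Φ x‖ ^ 2)
    rw [abs_of_nonneg (by positivity : (0 : ℝ) ≤ ‖Φ x‖ ^ 2)] at h1
    rw [Real.norm_eq_abs]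
    have h2 := mul_le_mul_of_nonneg_left (hF2 x) hM0
    have h3 := mul_le_mul_of_nonneg_left (hone' x) (abs_nonneg (h 0))
    have h4 := mul_nonneg hM0 (zero_le_one.trans (hone' x))
    rw [hCdef]
    nlinarith [hone' x]
  have hgb : ∀ x, ‖h' (‖Φ x‖ ^ 2) • (2 : ℝ) • Φ x‖ ≤ C * (1 + ‖x‖) ^ 2 := fun x => by
    rw [norm_smul, norm_smul, Real.norm_of_nonneg (by norm_num : (0 : ℝ) ≤ 2), Real.norm_eq_abs]
    calc |h' (‖Φ x‖ ^ 2)| * (2 * ‖Φ x‖) ≤ M * (2 * (1 + ‖x‖) ^ 2) := by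
          gcongr
          · exact hM _
          · exact (hΦ.norm_le x).trans (hone x)
      _ = (2 * M) * (1 + ‖x‖) ^ 2 := by ring
      _ ≤ C * (1 + ‖x‖) ^ 2 := by
          gcongr
          have := abs_nonneg (h 0)
          linarith
  have hG : ∀ x, HasGradientAt (fun x => h (‖Φ x‖ ^ 2)) (h' (‖Φ x‖ ^ 2) • (2 : ℝ) • Φ x) x :=
    fun x => by
      have := (hh (‖Φ x‖ ^ 2)).comp_hasFDerivAt x (hΦ.hasGradientAt x).hasFDerivAt
      rw [hasGradientAt_iff_hasFDerivAt]
      refine this.congr_fderiv ?_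
      ext z
      simp
  have hcov := gaussian_covariance_formula (fun x => hΦ.hasGradientAt x) (by fun_prop) hG
    (by fun_prop) hFb hfb hGb hgb
  have hFi := hΦ.integrable_norm_sq
  have hGi : Integrable (fun x => h (‖Φ x‖ ^ 2)) (stdGaussian E) :=
    integrable_of_norm_le_pow _ (Continuous.aestronglyMeasurable (by fun_prop)) C 2 hGb
  have hGFi : Integrable (fun x => h (‖Φ x‖ ^ 2) * ‖Φ x‖ ^ 2) (stdGaussian E) := by
    refine integrable_of_norm_le_pow _ (Continuous.aestronglyMeasurable (by fun_prop)) (C * C) 4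
      fun x => ?_
    rw [norm_mul]
    calc _ ≤ (C * (1 + ‖x‖) ^ 2) * (C * (1 + ‖x‖) ^ 2) := by
          gcongr
          · exact hGb x
          · exact hFb x
      _ = _ := by ring
  have hlhs : ∫ x, (‖Φ x‖ ^ 2 - ∫ z, ‖Φ z‖ ^ 2 ∂(stdGaussian E)) * h (‖Φ x‖ ^ 2) ∂(stdGaussian E)
      = ∫ x, h (‖Φ x‖ ^ 2) * ‖Φ x‖ ^ 2 ∂(stdGaussian E)
        - (∫ x, h (‖Φ x‖ ^ 2) ∂(stdGaussian E)) * ∫ x, ‖Φ x‖ ^ 2 ∂(stdGaussian E) := by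
    rw [← integral_mul_const, ← integral_sub hGFi (hGi.mul_const _)]
    congr 1 with x
    ring
  rw [hlhs, hcov, ← integral_sinMeasure]
  set K : ℝ → E × E → ℝ := fun θ p =>
    ⟪h' (‖Φ p.1‖ ^ 2) • (2 : ℝ) • Φ p.1, (2 : ℝ) • Φ (circlePt θ p)⟫ with hKdef
  have hKc : Continuous fun q : ℝ × (E × E) => K q.1 q.2 := by
    have := hΦ.continuous.comp (continuous_circlePt (E := E))
    simp only [Function.comp_def] at this
    simp only [hKdef]
    fun_prop
  have hKb : ∀ θ p, ‖K θ p‖ ≤ 4 * M * (‖p.1‖ + ‖p.2‖) ^ 2 := fun θ p => by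
    refine (norm_inner_le_norm _ _).trans ?_
    rw [norm_smul, norm_smul, norm_smul, Real.norm_of_nonneg (by norm_num : (0 : ℝ) ≤ 2)]
    calc ‖h' (‖Φ p.1‖ ^ 2)‖ * (2 * ‖Φ p.1‖) * (2 * ‖Φ (circlePt θ p)‖)
        ≤ M * (2 * (‖p.1‖ + ‖p.2‖)) * (2 * (‖p.1‖ + ‖p.2‖)) := by
          gcongr
          · exact hM _
          · exact (hΦ.norm_le _).trans (by linarith [norm_nonneg p.2])
          · exact hΦ.norm_comp_circlePt_le θ p
      _ = _ := by ring
  rw [← integral_integral_circlePt hKc (integrable_add_norm_sq.const_mul _) hKb]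
  congr 1 with x
  simp only [hKdef, real_inner_smul_left, real_inner_smul_right]
  rw [integral_const_mul, integral_const_mul, integral_const_mul, ← hΦ.inner_circleAvg]
  ring

end IsConicProj

end ConicProjection

/-! ### Gaussian Poincaré inequality and the variance of the Stein kernel -/

section GaussianPoincare

open scoped RealInnerProductSpace NNReal ENNReal

/-- Leads to absolute continuity of `stdGaussian`, so that Rademacher's Lebesgue-a.e.
differentiability also holds Gaussian-a.e. -/
lemma pi_absolutelyContinuous {n : ℕ} (μ ν : Fin n → Measure ℝ) [∀ i, SigmaFinite (μ i)]
    [∀ i, SigmaFinite (ν i)] (h : ∀ i, μ i ≪ ν i) : Measure.pi μ ≪ Measure.pi ν := by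
  induction n with
  | zero =>
    rw [Measure.pi_of_empty μ 0, Measure.pi_of_empty ν 0]
  | succ n ih =>
    have h1 := measurePreserving_piFinSuccAbove μ 0
    have h2 := measurePreserving_piFinSuccAbove ν 0
    have h3 := (h 0).prod (ih (fun i => μ ((0 : Fin (n + 1)).succAbove i))
      (fun i => ν ((0 : Fin (n + 1)).succAbove i)) fun i => h _)
    have h4 := h3.map (MeasurableEquiv.piFinSuccAbove (fun _ => ℝ) 0).symm.measurable
    rwa [(h1.symm _).map_eq, (h2.symm _).map_eq] at h4

variable {E : Type*} [NormedAddCommGroup E] [InnerProductSpace ℝ E] [FiniteDimensional ℝ E]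
  [MeasurableSpace E] [BorelSpace E]

lemma stdGaussian_euclidean_absolutelyContinuous (n : ℕ) :
    stdGaussian (EuclideanSpace ℝ (Fin n)) ≪ volume := by
  rw [← map_pi_eq_stdGaussian, ← (PiLp.volume_preserving_toLp (Fin n)).map_eq]
  refine Measure.AbsolutelyContinuous.map ?_ (by fun_prop)
  exact pi_absolutelyContinuous _ _ fun _ => gaussianReal_absolutelyContinuous 0 one_ne_zero

lemma stdGaussian_absolutelyContinuous : stdGaussian E ≪ volume := by
  let e := (stdOrthonormalBasis ℝ E).repr.symm
  rw [← stdGaussian_map e, ← e.measurePreserving.map_eq]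
  exact (stdGaussian_euclidean_absolutelyContinuous _).map e.continuous.measurable

lemma lintegral_sq_apply_stdGaussian (L : E →L[ℝ] ℝ) :
    ∫⁻ v, ‖L v‖ₑ ^ 2 ∂(stdGaussian E) = ‖L‖ₑ ^ 2 := by
  have hm : MemLp L 2 (stdGaussian E) := IsGaussian.memLp_dual _ L 2 (by simp)
  have h := variance_dual_stdGaussian L
  rw [variance_eq_sub hm, integral_strongDual_stdGaussian] at h
  simp only [Pi.pow_apply, ne_eq, OfNat.ofNat_ne_zero, not_false_eq_true, zero_pow,
    sub_zero] at h
  have h2 : ∫⁻ v, ENNReal.ofReal (L v ^ 2) ∂(stdGaussian E)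
      = ENNReal.ofReal (∫ v, L v ^ 2 ∂(stdGaussian E)) :=
    (ofReal_integral_eq_lintegral_ofReal hm.integrable_sq (ae_of_all _ fun _ => sq_nonneg _)).symm
  rw [h] at h2
  have h3 : ∀ r : ℝ, ENNReal.ofReal (r ^ 2) = ‖r‖ₑ ^ 2 := fun r => by
    rw [Real.enorm_eq_ofReal_abs, ← ENNReal.ofReal_pow (abs_nonneg r), sq_abs]
  simp only [h3] at h2
  rw [h2, enorm_norm]

lemma sq_lintegral_le {α : Type*} [MeasurableSpace α] (μ : Measure α) {w : α → ℝ≥0∞}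
    (hw : AEMeasurable w μ) : (∫⁻ a, w a ∂μ) ^ 2 ≤ μ Set.univ * ∫⁻ a, w a ^ 2 ∂μ := by
  have h := ENNReal.lintegral_mul_le_Lp_mul_Lq μ Real.HolderConjugate.two_two (f := w) (g := 1)
    hw aemeasurable_one
  simp only [mul_one, Pi.one_apply, lintegral_const, ENNReal.rpow_two, one_pow, one_mul] at h
  have hs : ∀ x : ℝ≥0∞, (x ^ (1 / 2 : ℝ)) ^ 2 = x := fun x => by
    rw [← ENNReal.rpow_two, ← ENNReal.rpow_mul]
    norm_num
  calc (∫⁻ a, w a ∂μ) ^ 2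
      ≤ ((∫⁻ a, w a ^ 2 ∂μ) ^ (1 / 2 : ℝ) * (μ Set.univ) ^ (1 / 2 : ℝ)) ^ 2 := by gcongr
    _ = _ := by rw [mul_pow, hs, hs, mul_comm]

/-- A Gaussian Poincaré inequality, obtained by interpolating along quarter circles. -/
lemma lintegral_sub_sq_le {G : E → ℝ} (hG : LocallyLipschitz G)
    (hd : ∀ᵐ x ∂(stdGaussian E), DifferentiableAt ℝ G x) :
    ∫⁻ p, ‖G p.2 - G p.1‖ₑ ^ 2 ∂((stdGaussian E).prod (stdGaussian E))
      ≤ ENNReal.ofReal (Real.pi / 2) ^ 2 * ∫⁻ x, ‖fderiv ℝ G x‖ₑ ^ 2 ∂(stdGaussian E) := by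
  set I : Set ℝ := Set.Ioc 0 (Real.pi / 2) with hI
  set γ₂ := (stdGaussian E).prod (stdGaussian E) with hγ₂
  set w : ℝ × (E × E) → ℝ := fun q => fderiv ℝ G (circlePt q.1 q.2) (circleVel q.1 q.2) with hw
  have hwm₀ : Measurable fun q : E × E => fderiv ℝ G q.1 q.2 :=
    isBoundedBilinearMap_apply.continuous.measurable.comp
      (((measurable_fderiv ℝ G).comp measurable_fst).prodMk measurable_snd)
  have hwm : Measurable w :=
    hwm₀.comp (continuous_circlePt.measurable.prodMk continuous_circleVel.measurable)
  -- `G` is differentiable only almost everywhere, yet almost every path meets the exceptional set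
  -- in a null set of angles: by Fubini it suffices to fix `θ`, when the position is standard
  -- Gaussian.
  have hpath : ∀ᵐ p ∂γ₂, ∀ᵐ θ ∂(volume.restrict I), DifferentiableAt ℝ G (circlePt θ p) := by
    have hset : MeasurableSet {q : (E × E) × ℝ | DifferentiableAt ℝ G (circlePt q.2 q.1)} :=
      (measurableSet_of_differentiableAt ℝ G).preimage
        (continuous_circlePt.comp continuous_swap).measurable
    rw [Measure.ae_ae_comm hset]
    exact ae_of_all _ fun θ => (measurePreserving_circlePt θ).quasiMeasurePreserving.ae hd
  have hFTC : ∀ᵐ p ∂γ₂, G p.2 - G p.1 = ∫ θ in I, w (θ, p) := by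
    filter_upwards [hpath] with p hp
    have hll : LocallyLipschitz fun θ => G (circlePt θ p) := by
      refine hG.comp (ContDiff.locallyLipschitz (𝕂 := ℝ) ?_)
      unfold circlePt
      fun_prop
    -- Along one path over a compact interval `G` is Lipschitz, hence absolutely continuous, so the
    -- fundamental theorem applies.
    obtain ⟨K, hK⟩ := LocallyLipschitzOn.exists_lipschitzOnWith_of_compact
      (isCompact_uIcc (a := 0) (b := Real.pi / 2)) hll.locallyLipschitzOn
    have h := hK.absolutelyContinuousOnInterval.integral_deriv_eq_sub
    rw [circlePt_zero, circlePt_pi_div_two] at h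
    rw [← h, intervalIntegral.integral_of_le (by positivity)]
    refine integral_congr_ae ?_
    filter_upwards [hp] with θ hθ
    exact (hθ.hasFDerivAt.comp_hasDerivAt θ (hasDerivAt_circlePt θ p)).deriv
  have hI' : (volume.restrict I) Set.univ = ENNReal.ofReal (Real.pi / 2) := by
    simp [hI]
  -- The velocity is a standard Gaussian independent of the position; averaging over it replaces the
  -- squared directional derivative by the squared norm of the derivative.
  have hinner : ∀ θ, ∫⁻ p, ‖w (θ, p)‖ₑ ^ 2 ∂γ₂
      = ∫⁻ x, ‖fderiv ℝ G x‖ₑ ^ 2 ∂(stdGaussian E) := fun θ => by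
    have hm : Measurable fun q : E × E => ‖fderiv ℝ G q.1 q.2‖ₑ ^ 2 := hwm₀.enorm.pow_const 2
    have h := (measurePreserving_rotate (E := E) θ).lintegral_comp hm
    refine h.trans ?_
    rw [lintegral_prod _ hm.aemeasurable]
    simp only [lintegral_sq_apply_stdGaussian]
  -- One factor `π / 2` comes from Cauchy–Schwarz in `θ`, the other from integrating the constant
  -- `hinner` over `θ`.
  calc ∫⁻ p, ‖G p.2 - G p.1‖ₑ ^ 2 ∂γ₂
      ≤ ∫⁻ p, ENNReal.ofReal (Real.pi / 2) * (∫⁻ θ in I, ‖w (θ, p)‖ₑ ^ 2) ∂γ₂ := by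
        refine lintegral_mono_ae ?_
        filter_upwards [hFTC] with p hp
        rw [hp, ← hI']
        have hmp : Measurable fun θ => ‖w (θ, p)‖ₑ := (hwm.comp measurable_prodMk_right).enorm
        refine le_trans ?_ (sq_lintegral_le _ hmp.aemeasurable)
        gcongr
        exact enorm_integral_le_lintegral_enorm _
    _ = ENNReal.ofReal (Real.pi / 2) * ∫⁻ θ in I, ∫⁻ p, ‖w (θ, p)‖ₑ ^ 2 ∂γ₂ := by
        rw [lintegral_const_mul' _ _ ENNReal.ofReal_ne_top]
        congr 1
        refine lintegral_lintegral_swap ?_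
        exact ((hwm.comp measurable_swap).enorm.pow_const 2).aemeasurable
    _ = _ := by
        simp only [hinner]
        rw [lintegral_const, hI']
        ring

lemma integral_sub_sq_eq_two_mul_variance {G : E → ℝ} (hG : MemLp G 2 (stdGaussian E)) :
    ∫ p, (G p.2 - G p.1) ^ 2 ∂((stdGaussian E).prod (stdGaussian E))
      = 2 * variance G (stdGaussian E) := by
  have hi := hG.integrable one_le_two
  have hs := hG.integrable_sq
  have h : ∀ p : E × E, (G p.2 - G p.1) ^ 2
      = (1 * G p.2 ^ 2 + G p.1 ^ 2 * 1) - 2 * (G p.1 * G p.2) := fun p => by ring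
  simp only [h]
  have h1 := (integrable_const (1 : ℝ) (μ := stdGaussian E)).mul_prod hs
  have h2 := hs.mul_prod (integrable_const (1 : ℝ) (μ := stdGaussian E))
  have h12 := h1.add h2
  simp only [Pi.add_def] at h12
  rw [integral_sub h12 ((hi.mul_prod hi).const_mul 2), integral_add h1 h2,
    integral_prod_mul (fun _ => (1 : ℝ)) (fun x => G x ^ 2),
    integral_prod_mul (fun x => G x ^ 2) (fun _ => (1 : ℝ)), integral_const_mul,
    integral_prod_mul G G, variance_eq_sub hG]
  simp only [integral_const, probReal_univ, smul_eq_mul, Pi.pow_apply]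
  ring

/-- The Stein kernel of `‖Φ‖ ^ 2` under the standard Gaussian measure. -/
def steinKernel (Φ : E → E) (x : E) : ℝ := 4 * ⟪Φ x, circleAvg Φ x⟫

namespace IsConicProj

variable {Φ : E → E}

lemma locallyLipschitz_steinKernel (hΦ : IsConicProj Φ) : LocallyLipschitz (steinKernel Φ) := by
  have h1 : LocallyLipschitz fun q : E × E => 4 * ⟪q.1, q.2⟫ :=
    ContDiff.locallyLipschitz (𝕂 := ℝ) (contDiff_const.mul (contDiff_fst.inner ℝ contDiff_snd))
  exact h1.comp (hΦ.lipschitzWith.locallyLipschitz.prodMk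
    hΦ.circleAvg_lipschitzWith.locallyLipschitz)

/-- Product rule at points where Rademacher's theorem applies to both factors, with Lipschitz
constants 1 for `Φ` and 1/2 for `circleAvg Φ`. -/
lemma ae_hasFDerivAt_steinKernel (hΦ : IsConicProj Φ) :
    ∀ᵐ x ∂(stdGaussian E), DifferentiableAt ℝ (steinKernel Φ) x ∧
      ‖fderiv ℝ (steinKernel Φ) x‖ ≤ 4 * ‖circleAvg Φ x‖ + 2 * ‖Φ x‖ := by
  have h1 := stdGaussian_absolutelyContinuous.ae_le
    (hΦ.lipschitzWith.ae_differentiableAt (μ := volume))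
  have h2 := stdGaussian_absolutelyContinuous.ae_le
    (hΦ.circleAvg_lipschitzWith.ae_differentiableAt (μ := volume))
  filter_upwards [h1, h2] with x hx1 hx2
  have hd := (hx1.hasFDerivAt.inner ℝ hx2.hasFDerivAt).const_mul 4
  refine ⟨hd.differentiableAt, ?_⟩
  have hfd : fderiv ℝ (steinKernel Φ) x = _ := hd.fderiv
  rw [hfd]
  have hn1 := norm_fderiv_le_of_lipschitz ℝ hΦ.lipschitzWith (x₀ := x)
  have hn2 := norm_fderiv_le_of_lipschitz ℝ hΦ.circleAvg_lipschitzWith (x₀ := x)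
  refine ContinuousLinearMap.opNorm_le_bound _ (by positivity) fun v => ?_
  simp only [smul_apply, ContinuousLinearMap.comp_apply,
    ContinuousLinearMap.prod_apply, fderivInnerCLM_apply, smul_eq_mul, norm_mul]
  have e1 : ‖⟪Φ x, fderiv ℝ (circleAvg Φ) x v⟫‖ ≤ ‖Φ x‖ * (1 / 2 * ‖v‖) := by
    refine (norm_inner_le_norm _ _).trans ?_
    gcongr
    exact (ContinuousLinearMap.le_of_opNorm_le _ hn2 v).trans (le_of_eq (by simp))
  have e2 : ‖⟪fderiv ℝ Φ x v, circleAvg Φ x⟫‖ ≤ ‖v‖ * ‖circleAvg Φ x‖ := by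
    refine (norm_inner_le_norm _ _).trans ?_
    gcongr
    exact (ContinuousLinearMap.le_of_opNorm_le _ hn1 v).trans (le_of_eq (by simp))
  have e3 := norm_add_le ⟪Φ x, fderiv ℝ (circleAvg Φ) x v⟫ ⟪fderiv ℝ Φ x v, circleAvg Φ x⟫
  rw [Real.norm_of_nonneg (by norm_num : (0 : ℝ) ≤ 4)]
  linarith

lemma continuous_steinKernel (hΦ : IsConicProj Φ) : Continuous (steinKernel Φ) :=
  hΦ.locallyLipschitz_steinKernel.continuous

lemma memLp_steinKernel (hΦ : IsConicProj Φ) : MemLp (steinKernel Φ) 2 (stdGaussian E) := by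
  obtain ⟨C, hC⟩ := hΦ.norm_circleAvg_le
  have hC0 : 0 ≤ C := by simpa using (norm_nonneg _).trans (hC 0)
  rw [memLp_two_iff_integrable_sq hΦ.continuous_steinKernel.aestronglyMeasurable]
  refine integrable_of_norm_le_pow _ (hΦ.continuous_steinKernel.pow 2).aestronglyMeasurable
    ((4 * C) ^ 2) 4 fun x => ?_
  rw [norm_pow]
  calc ‖steinKernel Φ x‖ ^ 2 ≤ (4 * ((1 + ‖x‖) * (C * (1 + ‖x‖)))) ^ 2 := by
        gcongr
        rw [steinKernel, norm_mul, Real.norm_of_nonneg (by norm_num : (0 : ℝ) ≤ 4)]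
        gcongr
        refine (norm_inner_le_norm _ _).trans ?_
        gcongr
        · linarith [hΦ.norm_le x]
        · exact hC x
    _ = _ := by ring

lemma variance_steinKernel_le (hΦ : IsConicProj Φ) :
    variance (steinKernel Φ) (stdGaussian E) ≤ 64 * ∫ x, ‖Φ x‖ ^ 2 ∂(stdGaussian E) := by
  set δ := ∫ x, ‖Φ x‖ ^ 2 ∂(stdGaussian E) with hδ
  have hδ0 : 0 ≤ δ := integral_nonneg fun x => by positivity
  have hFi := hΦ.integrable_norm_sq
  have hQi := hΦ.integrable_norm_circleAvg_sq
  have hP := lintegral_sub_sq_le hΦ.locallyLipschitz_steinKernel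
    (hΦ.ae_hasFDerivAt_steinKernel.mono fun x hx => hx.1)
  have hbound : ∫⁻ x, ‖fderiv ℝ (steinKernel Φ) x‖ₑ ^ 2 ∂(stdGaussian E)
      ≤ ENNReal.ofReal (36 * δ) := by
    calc ∫⁻ x, ‖fderiv ℝ (steinKernel Φ) x‖ₑ ^ 2 ∂(stdGaussian E)
        ≤ ∫⁻ x, ENNReal.ofReal (24 * ‖circleAvg Φ x‖ ^ 2 + 12 * ‖Φ x‖ ^ 2) ∂(stdGaussian E) := by
          refine lintegral_mono_ae ?_
          filter_upwards [hΦ.ae_hasFDerivAt_steinKernel] with x hx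
          rw [← ofReal_norm, ← ENNReal.ofReal_pow (norm_nonneg _)]
          refine ENNReal.ofReal_le_ofReal ?_
          refine (pow_le_pow_left₀ (norm_nonneg _) hx.2 2).trans ?_
          -- `(4a + 2b)² ≤ 24a² + 12b²`, since `16ab ≤ 8a² + 8b²`.
          nlinarith [sq_nonneg (‖circleAvg Φ x‖ - ‖Φ x‖)]
      _ = ENNReal.ofReal (∫ x, (24 * ‖circleAvg Φ x‖ ^ 2 + 12 * ‖Φ x‖ ^ 2) ∂(stdGaussian E)) :=
          (ofReal_integral_eq_lintegral_ofReal ((hQi.const_mul 24).add (hFi.const_mul 12))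
            (ae_of_all _ fun x =>
              (by positivity : (0 : ℝ) ≤ 24 * ‖circleAvg Φ x‖ ^ 2 + 12 * ‖Φ x‖ ^ 2))).symm
      _ ≤ ENNReal.ofReal (36 * δ) := by
          refine ENNReal.ofReal_le_ofReal ?_
          rw [integral_add (hQi.const_mul 24) (hFi.const_mul 12), integral_const_mul,
            integral_const_mul]
          linarith [hΦ.integral_norm_circleAvg_sq_le]
  have hm := hΦ.memLp_steinKernel
  have hv := integral_sub_sq_eq_two_mul_variance hm
  have hle : ∫ p, (steinKernel Φ p.2 - steinKernel Φ p.1) ^ 2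
      ∂((stdGaussian E).prod (stdGaussian E)) ≤ (Real.pi / 2) ^ 2 * (36 * δ) := by
    rw [integral_eq_lintegral_of_nonneg_ae (ae_of_all _ fun p => sq_nonneg _)
      (Continuous.aestronglyMeasurable (by have := hΦ.continuous_steinKernel; fun_prop))]
    refine ENNReal.toReal_le_of_le_ofReal (mul_nonneg (sq_nonneg _) (by linarith)) ?_
    have h3 : ∀ r : ℝ, ENNReal.ofReal (r ^ 2) = ‖r‖ₑ ^ 2 := fun r => by
      rw [Real.enorm_eq_ofReal_abs, ← ENNReal.ofReal_pow (abs_nonneg r), sq_abs]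
    simp only [h3]
    rw [ENNReal.ofReal_mul (sq_nonneg _), ENNReal.ofReal_pow Real.pi_div_two_pos.le]
    exact hP.trans (by gcongr)
  rw [hv] at hle
  -- Halving `hle` bounds the variance by `(9/2)π²δ ≤ 45δ`; 64 is a larger perfect square.
  have hpi : Real.pi ^ 2 ≤ 10 := by nlinarith [Real.pi_lt_d2, Real.pi_pos]
  nlinarith [mul_le_mul_of_nonneg_right hpi hδ0]

/-- For `u = Φ x₀`, one of `x` and `-x` has nonnegative inner product with `u`, and there `⟪u, ·⟫ ≤
‖u‖ ‖Φ ·‖`. Squaring and integrating, with the symmetry of the Gaussian, even shows that the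
integral is at least 1/2. -/
lemma integral_norm_sq_pos (hΦ : IsConicProj Φ) {x₀ : E} (h₀ : Φ x₀ ≠ 0) :
    0 < ∫ x, ‖Φ x‖ ^ 2 ∂(stdGaussian E) := by
  set u := Φ x₀
  have hu : 0 < ‖u‖ ^ 2 := by positivity
  have hle : ∀ x, ⟪u, x⟫ * ⟪u, x⟫ ≤ ‖u‖ ^ 2 * (‖Φ x‖ ^ 2 + ‖Φ (-x)‖ ^ 2) := fun x => by
    have key : ∀ y, 0 ≤ ⟪u, y⟫ → ⟪u, y⟫ * ⟪u, y⟫ ≤ ‖u‖ ^ 2 * ‖Φ y‖ ^ 2 := fun y hy => by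
      have h1 : ⟪u, y⟫ ≤ ‖u‖ * ‖Φ y‖ := (hΦ.inner_le x₀ y).trans (real_inner_le_norm _ _)
      nlinarith
    rcases le_total 0 ⟪u, x⟫ with h | h
    · nlinarith [key x h, mul_nonneg hu.le (sq_nonneg ‖Φ (-x)‖)]
    · have := key (-x) (by rw [inner_neg_right]; linarith)
      rw [inner_neg_right] at this
      nlinarith [mul_nonneg hu.le (sq_nonneg ‖Φ x‖)]
  have hneg : MeasurePreserving (fun x : E => -x) (stdGaussian E) (stdGaussian E) :=
    ⟨measurable_neg, stdGaussian_map (LinearIsometryEquiv.neg ℝ (E := E))⟩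
  have hi := hΦ.integrable_norm_sq
  have hi' : Integrable (fun x => ‖Φ (-x)‖ ^ 2) (stdGaussian E) :=
    hneg.integrable_comp_of_integrable hi
  have he : ∫ x, ‖Φ (-x)‖ ^ 2 ∂(stdGaussian E) = ∫ x, ‖Φ x‖ ^ 2 ∂(stdGaussian E) := by
    conv_rhs => rw [← hneg.map_eq]
    exact (integral_map measurable_neg.aemeasurable
      (hΦ.continuous.norm.pow 2).aestronglyMeasurable).symm
  have hm : MemLp (fun x => ⟪u, x⟫) 2 (stdGaussian E) :=
    IsGaussian.memLp_dual _ (innerSL ℝ u) 2 (by simp)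
  have h := integral_mono (hm.integrable_mul hm) ((hi.add hi').const_mul (‖u‖ ^ 2)) hle
  simp only [Pi.mul_apply, integral_inner_mul_inner, Pi.add_apply] at h
  rw [integral_const_mul, integral_add hi hi', he, real_inner_self_eq_norm_sq] at h
  nlinarith

end IsConicProj

end GaussianPoincare

/-! ### Stein's equation and total variation by continuous test functions -/

section Stein

lemma hasDerivAt_gaussianPDFReal (x : ℝ) :
    HasDerivAt (gaussianPDFReal 0 1) (-x * gaussianPDFReal 0 1 x) x := by
  have h : HasDerivAt (fun x : ℝ => (√(2 * Real.pi * (1 : NNReal)))⁻¹ *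
      Real.exp (-(x - 0) ^ 2 / (2 * (1 : NNReal)))) _ x :=
    (((((hasDerivAt_id x).sub_const 0).pow 2).neg.div_const _).exp).const_mul _
  rw [gaussianPDFReal_def]
  refine h.congr_deriv ?_
  simp
  ring

lemma continuous_gaussianPDFReal : Continuous (gaussianPDFReal 0 1) :=
  continuous_iff_continuousAt.2 fun x => (hasDerivAt_gaussianPDFReal x).continuousAt

lemma integrable_mul_gaussianPDFReal : Integrable fun x => x * gaussianPDFReal 0 1 x := by
  have h := (integrable_mul_exp_neg_mul_sq (b := 1 / 2) (by norm_num)).const_mul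
    (√(2 * Real.pi * (1 : NNReal)))⁻¹
  refine h.congr (ae_of_all _ fun x => ?_)
  simp only [gaussianPDFReal_def]
  have : -(x - 0) ^ 2 / (2 * ((1 : NNReal) : ℝ)) = -(1 / 2) * x ^ 2 := by
    rw [NNReal.coe_one]; ring
  rw [this]
  ring

lemma setIntegral_Ioi_mul_gaussianPDFReal (x : ℝ) :
    ∫ t in Set.Ioi x, t * gaussianPDFReal 0 1 t = gaussianPDFReal 0 1 x := by
  have hd : ∀ t ∈ Set.Ici x, HasDerivAt (fun t => -gaussianPDFReal 0 1 t)
      (t * gaussianPDFReal 0 1 t) t := fun t _ => by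
    exact (hasDerivAt_gaussianPDFReal t).neg.congr_deriv (by ring)
  have hlim := tendsto_zero_of_hasDerivAt_of_integrableOn_Ioi (a := x)
    (fun t ht => hd t (Set.mem_Ici_of_Ioi ht)) integrable_mul_gaussianPDFReal.integrableOn
    (integrable_gaussianPDFReal 0 1).neg.integrableOn
  have := integral_Ioi_of_hasDerivAt_of_tendsto' hd integrable_mul_gaussianPDFReal.integrableOn hlim
  simpa using this

lemma setIntegral_Iic_mul_gaussianPDFReal (x : ℝ) :
    ∫ t in Set.Iic x, t * gaussianPDFReal 0 1 t = -gaussianPDFReal 0 1 x := by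
  have hd : ∀ t ∈ Set.Iic x, HasDerivAt (fun t => -gaussianPDFReal 0 1 t)
      (t * gaussianPDFReal 0 1 t) t := fun t _ => by
    exact (hasDerivAt_gaussianPDFReal t).neg.congr_deriv (by ring)
  have hlim := tendsto_zero_of_hasDerivAt_of_integrableOn_Iic (a := x)
    hd integrable_mul_gaussianPDFReal.integrableOn
    (integrable_gaussianPDFReal 0 1).neg.integrableOn
  have := integral_Iic_of_hasDerivAt_of_tendsto' hd integrable_mul_gaussianPDFReal.integrableOn hlim
  simpa using this

/-- The Stein equation of the standard normal law, with the bound on the derivative of its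
solution. -/
lemma exists_stein_solution {g : ℝ → ℝ} (hg : Continuous g) (h0 : ∀ t, 0 ≤ g t)
    (h1 : ∀ t, g t ≤ 1) :
    ∃ f f' : ℝ → ℝ, (∀ x, HasDerivAt f (f' x) x) ∧ Continuous f' ∧ (∀ x, |f' x| ≤ 2) ∧
      ∀ x, f' x - x * f x = g x - ∫ t, g t ∂(gaussianReal 0 1) := by
  set c := ∫ t, g t ∂(gaussianReal 0 1) with hc
  set φ := gaussianPDFReal 0 1 with hφ
  have hφpos : ∀ x, 0 < φ x := fun x => gaussianPDFReal_pos 0 1 x one_ne_zero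
  have hφi : Integrable φ := integrable_gaussianPDFReal 0 1
  have hgi : Integrable g (gaussianReal 0 1) :=
    (integrable_const (1 : ℝ)).mono' hg.aestronglyMeasurable
      (ae_of_all _ fun t => by rw [Real.norm_of_nonneg (h0 t)]; exact h1 t)
  have hc0 : 0 ≤ c := integral_nonneg h0
  have hc1 : c ≤ 1 := by
    have := integral_mono hgi (integrable_const (1 : ℝ)) h1
    simpa using this
  have hgc : ∀ t, |g t - c| ≤ 1 := fun t =>
    abs_le.2 ⟨by linarith [h0 t], by linarith [h1 t]⟩
  set k : ℝ → ℝ := fun t => (g t - c) * φ t with hk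
  have hφc : Continuous φ := continuous_gaussianPDFReal
  have hkc : Continuous k := by fun_prop
  have hkb : ∀ t, ‖k t‖ ≤ φ t := fun t => by
    rw [norm_mul, Real.norm_of_nonneg (hφpos t).le]
    exact mul_le_of_le_one_left (hφpos t).le (hgc t)
  have hki : Integrable k := hφi.mono' hkc.aestronglyMeasurable (ae_of_all _ hkb)
  have hgφ : Integrable fun t => g t * φ t :=
    hφi.mono' (Continuous.aestronglyMeasurable (by fun_prop)) (ae_of_all _ fun t => by
      rw [norm_mul, Real.norm_of_nonneg (hφpos t).le, Real.norm_of_nonneg (h0 t)]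
      exact mul_le_of_le_one_left (hφpos t).le (h1 t))
  have hk0 : ∫ t, k t = 0 := by
    have e1 : ∫ t, g t * φ t = c := by
      rw [hc, integral_gaussianReal_eq_integral_smul one_ne_zero]
      simp only [smul_eq_mul, mul_comm, hφ]
    have e2 : ∫ t, c * φ t = c := by
      rw [integral_const_mul, integral_gaussianPDFReal_eq_one 0 one_ne_zero, mul_one]
    simp only [hk, sub_mul]
    rw [integral_sub hgφ (hφi.const_mul c), e1, e2, sub_self]
  set S : ℝ → ℝ := fun x => ∫ t in Set.Iic x, k t with hS
  have hSd : ∀ x, HasDerivAt S (k x) x := fun x => by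
    have e : S = fun x => S 0 + ∫ t in (0 : ℝ)..x, k t := by
      funext y
      rw [← intervalIntegral.integral_Iic_sub_Iic hki.integrableOn hki.integrableOn]
      simp [hS]
    rw [e]
    exact (intervalIntegral.integral_hasDerivAt_right (hkc.intervalIntegrable _ _)
      (hkc.stronglyMeasurableAtFilter _ _) hkc.continuousAt).const_add _
  have hSc : Continuous S := continuous_iff_continuousAt.2 fun x => (hSd x).continuousAt
  -- Mills-ratio bound. As `k` has total integral zero, `S` is also minus the upper tail; on the
  -- tail beyond `x`, `|x| ≤ |t|`, and `t φ(t)` integrates exactly.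
  have hSb : ∀ x, |x * S x| ≤ φ x := fun x => by
    rw [abs_mul]
    rcases le_total 0 x with hx | hx
    · have e : S x = -∫ t in Set.Ioi x, k t := by
        have := intervalIntegral.integral_Iic_add_Ioi (b := x) hki.integrableOn hki.integrableOn
        rw [hk0] at this
        linarith
      rw [e, abs_neg, abs_of_nonneg hx, hφ, ← setIntegral_Ioi_mul_gaussianPDFReal x]
      have hb : |∫ t in Set.Ioi x, k t| ≤ ∫ t in Set.Ioi x, φ t :=
        norm_integral_le_of_norm_le hφi.integrableOn (ae_of_all _ hkb)
      refine (mul_le_mul_of_nonneg_left hb hx).trans ?_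
      rw [← integral_const_mul]
      refine setIntegral_mono_on (hφi.const_mul x).integrableOn
        integrable_mul_gaussianPDFReal.integrableOn measurableSet_Ioi fun t ht => ?_
      exact mul_le_mul_of_nonneg_right (le_of_lt ht) (hφpos t).le
    · rw [abs_of_nonpos hx]
      have hb : |S x| ≤ ∫ t in Set.Iic x, φ t :=
        norm_integral_le_of_norm_le hφi.integrableOn (ae_of_all _ hkb)
      refine (mul_le_mul_of_nonneg_left hb (neg_nonneg.2 hx)).trans ?_
      have h2 : ∫ t in Set.Iic x, t * φ t ≤ ∫ t in Set.Iic x, x * φ t :=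
        setIntegral_mono_on integrable_mul_gaussianPDFReal.integrableOn
          (hφi.const_mul x).integrableOn measurableSet_Iic fun t ht =>
            mul_le_mul_of_nonneg_right ht (hφpos t).le
      rw [setIntegral_Iic_mul_gaussianPDFReal, integral_const_mul] at h2
      rw [neg_mul]
      linarith
  -- `S / φ` solves the equation by the integrating factor `φ`. The bound 2 is 1 from `x * f x` plus
  -- 1 from `g - c`.
  refine ⟨fun x => S x / φ x, fun x => x * (S x / φ x) + (g x - c), fun x => ?_, ?_, fun x => ?_,
    fun x => by ring⟩
  · refine ((hSd x).div (hasDerivAt_gaussianPDFReal x) (hφpos x).ne').congr_deriv ?_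
    have := (hφpos x).ne'
    simp only [hk, ← hφ]
    field_simp
    ring
  · have : Continuous fun x => S x / φ x := hSc.div hφc fun x => (hφpos x).ne'
    fun_prop
  · have h2 : |x * (S x / φ x)| ≤ 1 := by
      rw [← mul_div_assoc, abs_div, abs_of_pos (hφpos x), div_le_one (hφpos x)]
      exact hSb x
    have := abs_add_le (x * (S x / φ x)) (g x - c)
    linarith [hgc x]

/-- Total variation distance is controlled by continuous test functions with values in
`[0, 1]`. -/
lemma tvDist_le_of_continuous {P Q : Measure ℝ} [IsProbabilityMeasure P] [IsProbabilityMeasure Q]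
    {ε : ℝ} (h : ∀ g : ℝ → ℝ, Continuous g → (∀ t, 0 ≤ g t) → (∀ t, g t ≤ 1) →
      |∫ t, g t ∂P - ∫ t, g t ∂Q| ≤ ε) : tvDist P Q ≤ ε := by
  have : Nonempty {B : Set ℝ // MeasurableSet B} := ⟨⟨∅, MeasurableSet.empty⟩⟩
  refine ciSup_le fun ⟨B, hB⟩ => ?_
  refine le_of_forall_pos_le_add fun η hη => ?_
  -- Approximating in `L¹(P + Q)` controls the error under both laws at once; clipping to `[0, 1]`
  -- does not increase the distance to an indicator.
  have hBi : Integrable (B.indicator (fun _ => (1 : ℝ))) (P + Q) :=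
    (integrable_const (1 : ℝ)).indicator hB
  obtain ⟨g, hgle, hgi⟩ := hBi.exists_boundedContinuous_integral_sub_le hη
  set G : ℝ → ℝ := fun t => max 0 (min 1 (g t)) with hG
  have hGc : Continuous G := by fun_prop
  have hG0 : ∀ t, 0 ≤ G t := fun t => le_max_left _ _
  have hG1 : ∀ t, G t ≤ 1 := fun t => max_le zero_le_one (min_le_left _ _)
  have hcl : ∀ t, |B.indicator (fun _ => (1 : ℝ)) t - G t|
      ≤ ‖B.indicator (fun _ => (1 : ℝ)) t - g t‖ := fun t => by
    rw [Real.norm_eq_abs]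
    by_cases ht : t ∈ B
    · simp only [Set.indicator_of_mem ht, hG]
      grind
    · simp only [Set.indicator_of_notMem ht, hG]
      grind
  have hGi : ∀ ν : Measure ℝ, IsFiniteMeasure ν → Integrable G ν := fun ν _ =>
    (integrable_const (1 : ℝ)).mono' hGc.aestronglyMeasurable
      (ae_of_all _ fun t => by rw [Real.norm_of_nonneg (hG0 t)]; exact hG1 t)
  have hIi : ∀ ν : Measure ℝ, IsFiniteMeasure ν →
      Integrable (B.indicator (fun _ => (1 : ℝ))) ν := fun ν _ =>
    (integrable_const (1 : ℝ)).indicator hB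
  have hstep : ∀ ν : Measure ℝ, IsFiniteMeasure ν →
      |ν.real B - ∫ t, G t ∂ν| ≤ ∫ t, |B.indicator (fun _ => (1 : ℝ)) t - G t| ∂ν := fun ν hν => by
    have e : ν.real B = ∫ t, B.indicator (fun _ => (1 : ℝ)) t ∂ν := by
      rw [integral_indicator hB]; simp
    rw [e, ← integral_sub (hIi ν hν) (hGi ν hν)]
    exact abs_integral_le_integral_abs
  have hsum : ∫ t, |B.indicator (fun _ => (1 : ℝ)) t - G t| ∂P
      + ∫ t, |B.indicator (fun _ => (1 : ℝ)) t - G t| ∂Q ≤ η := by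
    have hd : ∀ ν : Measure ℝ, IsFiniteMeasure ν →
        Integrable (fun t => |B.indicator (fun _ => (1 : ℝ)) t - G t|) ν := fun ν hν =>
      ((hIi ν hν).sub (hGi ν hν)).abs
    rw [← integral_add_measure (hd P inferInstance) (hd Q inferInstance)]
    exact (integral_mono (hd _ inferInstance) (hBi.sub hgi).norm hcl).trans hgle
  have hP := abs_le.1 (hstep P inferInstance)
  have hQ := abs_le.1 (hstep Q inferInstance)
  have hPQ := abs_le.1 (h G hGc hG0 hG1)
  simp only
  rw [abs_le]
  constructor <;> linarith [hP.1, hP.2, hQ.1, hQ.2, hPQ.1, hPQ.2]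

end Stein

/-! ### Normal approximation of `‖Φ‖²` -/

section ConicCLT

open scoped RealInnerProductSpace

variable {E : Type*} [NormedAddCommGroup E] [InnerProductSpace ℝ E] [FiniteDimensional ℝ E]
  [MeasurableSpace E] [BorelSpace E] {Φ : E → E}

namespace IsConicProj

lemma memLp_norm_sq (hΦ : IsConicProj Φ) : MemLp (fun x => ‖Φ x‖ ^ 2) 2 (stdGaussian E) := by
  have hc := hΦ.continuous
  rw [memLp_two_iff_integrable_sq (Continuous.aestronglyMeasurable (by fun_prop))]
  refine integrable_of_norm_le_pow _ (Continuous.aestronglyMeasurable (by fun_prop)) 1 4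
    fun x => ?_
  rw [← pow_mul, norm_pow, norm_norm, one_mul]
  exact pow_le_pow_left₀ (norm_nonneg _) (by linarith [hΦ.norm_le x]) 4

/-- The kernel identity with `h = id`. -/
lemma integral_steinKernel (hΦ : IsConicProj Φ) :
    ∫ x, steinKernel Φ x ∂(stdGaussian E)
      = variance (fun x => ‖Φ x‖ ^ 2) (stdGaussian E) := by
  have h := hΦ.integral_mul_comp_norm_sq (h := id) (h' := fun _ => 1) (M := 1) hasDerivAt_id
    continuous_const (by simp)
  simp only [id, one_mul] at h
  have hs := hΦ.memLp_norm_sq.integrable_sq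
  rw [variance_eq_sub hΦ.memLp_norm_sq]
  refine h.symm.trans ?_
  simp only [sub_mul, ← sq]
  rw [integral_sub hs (hΦ.integrable_norm_sq.const_mul _), integral_const_mul]
  simp only [Pi.pow_apply, sq]

lemma two_mul_integral_le_variance (hΦ : IsConicProj Φ) :
    2 * ∫ x, ‖Φ x‖ ^ 2 ∂(stdGaussian E) ≤ variance (fun x => ‖Φ x‖ ^ 2) (stdGaussian E) := by
  rw [← hΦ.integral_steinKernel, ← integral_const_mul]
  refine integral_mono (hΦ.integrable_norm_sq.const_mul 2)
    (hΦ.memLp_steinKernel.integrable one_le_two) fun x => ?_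
  have := hΦ.half_norm_sq_le_inner_circleAvg x
  simp only [steinKernel]
  linarith

/-- The first absolute moment is at most the standard deviation, and `√(64δ) = 8√δ`. -/
lemma integral_abs_steinKernel_sub_le (hΦ : IsConicProj Φ) :
    ∫ x, |steinKernel Φ x - ∫ z, steinKernel Φ z ∂(stdGaussian E)| ∂(stdGaussian E)
      ≤ 8 * √(∫ x, ‖Φ x‖ ^ 2 ∂(stdGaussian E)) := by
  have hm : MemLp (fun x => |steinKernel Φ x - ∫ z, steinKernel Φ z ∂(stdGaussian E)|) 2
      (stdGaussian E) := (hΦ.memLp_steinKernel.sub (memLp_const _)).abs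
  have h1 := variance_nonneg
    (fun x => |steinKernel Φ x - ∫ z, steinKernel Φ z ∂(stdGaussian E)|) (stdGaussian E)
  rw [variance_eq_sub hm] at h1
  simp only [Pi.pow_apply, sq_abs] at h1
  rw [← variance_eq_integral hΦ.continuous_steinKernel.aemeasurable] at h1
  have h2 := hΦ.variance_steinKernel_le
  refine (sq_le_sq₀ (integral_nonneg fun x => abs_nonneg _) (by positivity)).1 ?_
  rw [mul_pow, Real.sq_sqrt (integral_nonneg fun x => by positivity)]
  linarith

/-- Normal approximation of the squared norm of the conic projection of a Gaussian vector. -/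
theorem tvDist_norm_sq_le (hΦ : IsConicProj Φ)
    (hδ : 0 < ∫ x, ‖Φ x‖ ^ 2 ∂(stdGaussian E)) :
    tvDist ((stdGaussian E).map fun x => (‖Φ x‖ ^ 2 - ∫ z, ‖Φ z‖ ^ 2 ∂(stdGaussian E))
        / √(variance (fun x => ‖Φ x‖ ^ 2) (stdGaussian E))) (gaussianReal 0 1)
      ≤ 8 / √(∫ x, ‖Φ x‖ ^ 2 ∂(stdGaussian E)) := by
  have hcΦ := hΦ.continuous
  have hker := hΦ.integral_abs_steinKernel_sub_le
  have hEker := hΦ.integral_steinKernel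
  have hv2 := hΦ.two_mul_integral_le_variance
  rw [hEker] at hker
  set δ := ∫ x, ‖Φ x‖ ^ 2 ∂(stdGaussian E) with hδdef
  set v := variance (fun x => ‖Φ x‖ ^ 2) (stdGaussian E) with hv
  have hvpos : 0 < v := by linarith
  set σ := √v with hσ
  have hσpos : 0 < σ := Real.sqrt_pos.2 hvpos
  have hσsq : σ ^ 2 = v := Real.sq_sqrt hvpos.le
  set W : E → ℝ := fun x => (‖Φ x‖ ^ 2 - δ) / σ with hW
  have hWc : Continuous W := by fun_prop
  have : IsProbabilityMeasure ((stdGaussian E).map W) :=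
    Measure.isProbabilityMeasure_map hWc.aemeasurable
  refine tvDist_le_of_continuous fun g hg h0 h1 => ?_
  rw [integral_map hWc.aemeasurable hg.aestronglyMeasurable]
  obtain ⟨f, f', hf, hf'c, hf'b, hst⟩ := exists_stein_solution hg h0 h1
  set c := ∫ t, g t ∂(gaussianReal 0 1) with hc
  have hfc : Continuous f := continuous_iff_continuousAt.2 fun t => (hf t).continuousAt
  have hgi : Integrable (fun x => g (W x)) (stdGaussian E) :=
    (integrable_const (1 : ℝ)).mono' (hg.comp hWc).aestronglyMeasurable
      (ae_of_all _ fun x => by rw [Real.norm_of_nonneg (h0 _)]; exact h1 _)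
  have hf'i : Integrable (fun x => f' (W x)) (stdGaussian E) :=
    (integrable_const (2 : ℝ)).mono' (hf'c.comp hWc).aestronglyMeasurable
      (ae_of_all _ fun x => hf'b _)
  have hWf : ∀ x, W x * f (W x) = f' (W x) - (g (W x) - c) := fun x => by
    linarith [hst (W x)]
  have hWfi : Integrable (fun x => W x * f (W x)) (stdGaussian E) := by
    simp only [hWf]
    exact hf'i.sub (hgi.sub (integrable_const c))
  have hΓi : Integrable (steinKernel Φ) (stdGaussian E) :=
    hΦ.memLp_steinKernel.integrable one_le_two
  have hf'Γ : Integrable (fun x => f' (W x) * steinKernel Φ x) (stdGaussian E) :=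
    hΓi.bdd_mul (hf'c.comp hWc).aestronglyMeasurable (ae_of_all _ fun x => hf'b (W x))
  have hker' : ∫ x, W x * f (W x) ∂(stdGaussian E)
      = v⁻¹ * ∫ x, f' (W x) * steinKernel Φ x ∂(stdGaussian E) := by
    -- The kernel identity is applied to the Stein solution precomposed with the standardization;
    -- the chain rule supplies the second `1 / σ` that makes `v⁻¹`.
    have hder : ∀ t, HasDerivAt (fun t => f ((t - δ) / σ)) (f' ((t - δ) / σ) / σ) t := fun t =>
      ((hf ((t - δ) / σ)).comp t (((hasDerivAt_id t).sub_const δ).div_const σ)).congr_deriv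
        (by simp [div_eq_mul_inv])
    have h := hΦ.integral_mul_comp_norm_sq (M := 2 / σ) hder (by fun_prop) fun t => by
      rw [abs_div, abs_of_pos hσpos]
      gcongr
      exact hf'b _
    have e1 : ∀ x, (‖Φ x‖ ^ 2 - δ) * f ((‖Φ x‖ ^ 2 - δ) / σ) = σ * (W x * f (W x)) := fun x => by
      simp only [hW]
      field_simp
    have e2 : ∀ x, f' ((‖Φ x‖ ^ 2 - δ) / σ) / σ * (4 * ⟪Φ x, circleAvg Φ x⟫)
        = σ⁻¹ * (f' (W x) * steinKernel Φ x) := fun x => by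
      simp only [hW, steinKernel]
      ring
    simp only [← hδdef, e1, e2] at h
    rw [integral_const_mul, integral_const_mul] at h
    rw [← hσsq]
    have := hσpos.ne'
    field_simp at h ⊢
    linarith
  have key : ∫ x, g (W x) ∂(stdGaussian E) - c
      = v⁻¹ * ∫ x, f' (W x) * (v - steinKernel Φ x) ∂(stdGaussian E) := by
    have e : ∀ x, f' (W x) * (v - steinKernel Φ x)
        = v * f' (W x) - f' (W x) * steinKernel Φ x := fun x => by ring
    simp only [e]
    rw [integral_sub (hf'i.const_mul v) hf'Γ, integral_const_mul, mul_sub, ← hker',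
      inv_mul_cancel_left₀ hvpos.ne', ← integral_sub hf'i hWfi]
    have e2 : ∀ x, f' (W x) - W x * f (W x) = g (W x) - c := fun x => by rw [hWf]; ring
    simp only [e2]
    rw [integral_sub hgi (integrable_const c)]
    simp
  have hb : |∫ x, f' (W x) * (v - steinKernel Φ x) ∂(stdGaussian E)| ≤ 2 * (8 * √δ) := by
    have hai : Integrable (fun x => |steinKernel Φ x - v|) (stdGaussian E) :=
      (hΓi.sub (integrable_const v)).abs
    have := norm_integral_le_of_norm_le (hai.const_mul 2)
      (f := fun x => f' (W x) * (v - steinKernel Φ x)) (ae_of_all _ fun x => by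
        rw [norm_mul, Real.norm_eq_abs, Real.norm_eq_abs, abs_sub_comm]
        exact mul_le_mul_of_nonneg_right (hf'b _) (abs_nonneg _))
    rw [integral_const_mul] at this
    exact this.trans (by linarith)
  rw [key, abs_mul, abs_of_pos (inv_pos.2 hvpos)]
  have hsδ : 0 < √δ := Real.sqrt_pos.2 hδ
  have hsq : √δ * √δ = δ := Real.mul_self_sqrt hδ.le
  -- Here `v ≥ 2δ` enters.
  calc v⁻¹ * |∫ x, f' (W x) * (v - steinKernel Φ x) ∂(stdGaussian E)|
      ≤ (2 * δ)⁻¹ * (2 * (8 * √δ)) := by gcongr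
    _ = 8 / √δ := by
        nth_rewrite 1 [← hsq]
        field_simp

end IsConicProj

end ConicCLT

/-! ### From the cone and the subspace to a conic projection -/

section MetricProjection

open scoped RealInnerProductSpace

variable {n : ℕ}

lemma metricProj_spec {K : Set (RVec n)} (hne : K.Nonempty) (hc : IsClosed K)
    (hconv : Convex ℝ K) (x : RVec n) :
    metricProj K x ∈ K ∧ ∀ z ∈ K, ⟪x - metricProj K x, z - metricProj K x⟫ ≤ 0 := by
  have hex : ∃ y, y ∈ K ∧ ∀ z ∈ K, ‖x - y‖ ^ 2 ≤ ‖x - z‖ ^ 2 := by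
    obtain ⟨y, hy, hmin⟩ := exists_norm_eq_iInf_of_complete_convex hne hc.isComplete hconv x
    refine ⟨y, hy, fun z hz => ?_⟩
    gcongr
    rw [hmin]
    exact ciInf_le ⟨0, by rintro _ ⟨w, rfl⟩; exact norm_nonneg _⟩ (⟨z, hz⟩ : K)
  obtain ⟨hmem, hle⟩ := Classical.epsilon_spec hex
  change metricProj K x ∈ K at hmem
  change ∀ z ∈ K, ‖x - metricProj K x‖ ^ 2 ≤ ‖x - z‖ ^ 2 at hle
  refine ⟨hmem, (norm_eq_iInf_iff_real_inner_le_zero hconv hmem).1 ?_⟩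
  have : Nonempty K := ⟨⟨_, hmem⟩⟩
  refine le_antisymm (le_ciInf fun z => ?_)
    (ciInf_le ⟨0, by rintro _ ⟨w, rfl⟩; exact norm_nonneg _⟩ (⟨_, hmem⟩ : K))
  exact (sq_le_sq₀ (norm_nonneg _) (norm_nonneg _)).1 (hle z z.2)

lemma metricProj_cone_mem (K : ProperCone ℝ (RVec n)) (x : RVec n) :
    metricProj (K : Set (RVec n)) x ∈ K :=
  (metricProj_spec K.nonempty K.isClosed K.convex x).1

lemma inner_sub_metricProj_cone_le (K : ProperCone ℝ (RVec n)) (x : RVec n) {k : RVec n}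
    (hk : k ∈ K) : ⟪x - metricProj (K : Set (RVec n)) x, k⟫ ≤ 0 := by
  have h := (metricProj_spec K.nonempty K.isClosed K.convex x).2 _
    (K.add_mem (metricProj_cone_mem K x) hk)
  simpa using h

lemma inner_sub_metricProj_cone_self (K : ProperCone ℝ (RVec n)) (x : RVec n) :
    ⟪x - metricProj (K : Set (RVec n)) x, metricProj (K : Set (RVec n)) x⟫ = 0 := by
  refine le_antisymm (inner_sub_metricProj_cone_le K x (metricProj_cone_mem K x)) ?_
  have h := (metricProj_spec K.nonempty K.isClosed K.convex x).2 0 K.zero_mem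
  rw [zero_sub, inner_neg_right] at h
  linarith

lemma metricProj_submodule_mem (L : Submodule ℝ (RVec n)) (x : RVec n) :
    metricProj (L : Set (RVec n)) x ∈ L :=
  (metricProj_spec L.nonempty L.closed_of_finiteDimensional L.convex x).1

lemma inner_sub_metricProj_submodule (L : Submodule ℝ (RVec n)) (x : RVec n) {l : RVec n}
    (hl : l ∈ L) : ⟪x - metricProj (L : Set (RVec n)) x, l⟫ = 0 := by
  have hspec := metricProj_spec L.nonempty L.closed_of_finiteDimensional L.convex x
  have h1 := hspec.2 _ (L.add_mem hspec.1 hl)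
  have h2 := hspec.2 _ (L.sub_mem hspec.1 hl)
  rw [add_sub_cancel_left] at h1
  rw [sub_sub_cancel_left, inner_neg_right] at h2
  linarith

/-- The difference of the metric projections onto a cone `K` and a subspace `L`; when `L ⊆ K` it
is the projection onto `K ∩ Lᗮ`. -/
def residualProj (L : Submodule ℝ (RVec n)) (K : ProperCone ℝ (RVec n)) (x : RVec n) : RVec n :=
  metricProj (K : Set (RVec n)) x - metricProj (L : Set (RVec n)) x

variable {L : Submodule ℝ (RVec n)} {K : ProperCone ℝ (RVec n)}

lemma inner_sub_metricProj_cone_eq_zero (hsub : (L : Set (RVec n)) ⊆ K) (x : RVec n)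
    {l : RVec n} (hl : l ∈ L) : ⟪x - metricProj (K : Set (RVec n)) x, l⟫ = 0 := by
  have h1 := inner_sub_metricProj_cone_le K x (hsub hl)
  have h2 := inner_sub_metricProj_cone_le K x (hsub (L.neg_mem hl))
  rw [inner_neg_right] at h2
  linarith

lemma inner_residualProj_eq_zero (hsub : (L : Set (RVec n)) ⊆ K) (x : RVec n) {l : RVec n}
    (hl : l ∈ L) : ⟪residualProj L K x, l⟫ = 0 := by
  have h1 := inner_sub_metricProj_cone_eq_zero hsub x hl
  have h2 := inner_sub_metricProj_submodule L x hl
  have : residualProj L K x = (x - metricProj (L : Set (RVec n)) x)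
      - (x - metricProj (K : Set (RVec n)) x) := by
    rw [residualProj]; abel
  rw [this, inner_sub_left, h1, h2, sub_zero]

lemma residualProj_mem (hsub : (L : Set (RVec n)) ⊆ K) (x : RVec n) :
    residualProj L K x ∈ K := by
  rw [residualProj, sub_eq_add_neg]
  exact K.add_mem (metricProj_cone_mem K x) (hsub (L.neg_mem (metricProj_submodule_mem L x)))

lemma inner_sub_metricProj_cone_residualProj (hsub : (L : Set (RVec n)) ⊆ K) (x : RVec n) :
    ⟪x - metricProj (K : Set (RVec n)) x, residualProj L K x⟫ = 0 := by
  rw [residualProj, inner_sub_right, inner_sub_metricProj_cone_self,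
    inner_sub_metricProj_cone_eq_zero hsub x (metricProj_submodule_mem L x), sub_zero]

/-- Split `y` into `Φ y`, the polar part `y - Π_K y` and `Π_L y`. Since `Φ x` lies in `K` and is
orthogonal to `L`, the last part drops out and the polar part contributes at most 0, and exactly 0
when `y = x`. -/
lemma isConicProj_residualProj (hsub : (L : Set (RVec n)) ⊆ K) :
    IsConicProj (residualProj L K) := by
  have hdec : ∀ x y, ⟪residualProj L K x, y⟫ = ⟪residualProj L K x, residualProj L K y⟫
      + ⟪y - metricProj (K : Set (RVec n)) y, residualProj L K x⟫ := fun x y => by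
    have h := inner_residualProj_eq_zero hsub x (metricProj_submodule_mem L y)
    have e : y = residualProj L K y + (y - metricProj (K : Set (RVec n)) y)
        + metricProj (L : Set (RVec n)) y := by rw [residualProj]; abel
    conv_lhs => rw [e]
    rw [inner_add_right, inner_add_right, h, add_zero,
      real_inner_comm (y - metricProj (K : Set (RVec n)) y)]
  refine ⟨fun x => ?_, fun x y => ?_⟩
  · rw [hdec, real_inner_self_eq_norm_sq]
    rw [inner_sub_metricProj_cone_residualProj hsub, add_zero]
  · rw [hdec]
    have := inner_sub_metricProj_cone_le K y (residualProj_mem hsub x)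
    linarith

lemma lrtStat_eq (hsub : (L : Set (RVec n)) ⊆ K) (x : RVec n) :
    lrtStat (L : Set (RVec n)) (K : Set (RVec n)) x = ‖residualProj L K x‖ ^ 2 := by
  have e : x - metricProj (L : Set (RVec n)) x
      = (x - metricProj (K : Set (RVec n)) x) + residualProj L K x := by
    rw [residualProj]; abel
  rw [lrtStat, e, norm_add_sq_real, inner_sub_metricProj_cone_residualProj hsub]
  ring

/-- Firm nonexpansiveness bounds the squared change by its inner product with `l`, which vanishes
because values of `Φ` are orthogonal to `L`. -/
lemma residualProj_add (hsub : (L : Set (RVec n)) ⊆ K) {l : RVec n} (hl : l ∈ L) (x : RVec n) :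
    residualProj L K (l + x) = residualProj L K x := by
  have h := (isConicProj_residualProj hsub).norm_sub_sq_le (l + x) x
  rw [add_sub_cancel_right, inner_sub_left, inner_residualProj_eq_zero hsub _ hl,
    inner_residualProj_eq_zero hsub _ hl, sub_zero] at h
  have h0 : ‖residualProj L K (l + x) - residualProj L K x‖ = 0 :=
    pow_eq_zero_iff two_ne_zero |>.1 (le_antisymm h (sq_nonneg _))
  exact sub_eq_zero.1 (norm_eq_zero.1 h0)

lemma norm_metricProj_cone_sq (hsub : (L : Set (RVec n)) ⊆ K) (x : RVec n) :
    ‖metricProj (K : Set (RVec n)) x‖ ^ 2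
      = ‖residualProj L K x‖ ^ 2 + ‖metricProj (L : Set (RVec n)) x‖ ^ 2 := by
  have e : metricProj (K : Set (RVec n)) x
      = residualProj L K x + metricProj (L : Set (RVec n)) x := by rw [residualProj]; abel
  rw [e, norm_add_sq_real, inner_residualProj_eq_zero hsub x (metricProj_submodule_mem L x)]
  ring

lemma isConicProj_metricProj_submodule (L : Submodule ℝ (RVec n)) :
    IsConicProj (metricProj (L : Set (RVec n))) := by
  have h : ∀ x y, ⟪metricProj (L : Set (RVec n)) x, y⟫
      = ⟪metricProj (L : Set (RVec n)) x, metricProj (L : Set (RVec n)) y⟫ := fun x y => by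
    have := inner_sub_metricProj_submodule L y (metricProj_submodule_mem L x)
    rw [real_inner_comm, inner_sub_right] at this
    linarith
  exact ⟨fun x => by rw [h, real_inner_self_eq_norm_sq], fun x y => (h x y).le⟩

lemma statDim_sub_statDim (hsub : (L : Set (RVec n)) ⊆ K) :
    statDim (K : Set (RVec n)) - statDim (L : Set (RVec n))
      = ∫ x, ‖residualProj L K x‖ ^ 2 ∂(stdGaussian (RVec n)) := by
  simp only [statDim, norm_metricProj_cone_sq hsub]
  rw [integral_add (isConicProj_residualProj hsub).integrable_norm_sq
    (isConicProj_metricProj_submodule L).integrable_norm_sq, add_sub_cancel_right]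

/-- A point of `K` is its own projection; were the residual zero, it would equal its projection onto
`L`. -/
lemma residualProj_ne_zero {k : RVec n} (hk : k ∈ K) (hkL : k ∉ L) :
    residualProj L K k ≠ 0 := by
  intro h0
  have h1 := inner_sub_metricProj_cone_le K k hk
  have h2 := inner_sub_metricProj_cone_self K k
  have h3 : ⟪k - metricProj (K : Set (RVec n)) k, k - metricProj (K : Set (RVec n)) k⟫ ≤ 0 := by
    rw [inner_sub_right, h2]; linarith
  have h4 := sub_eq_zero.1 (real_inner_self_nonpos.1 h3)
  rw [residualProj, ← h4, sub_eq_zero] at h0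
  rw [h0] at hkL
  exact hkL (metricProj_submodule_mem L k)

end MetricProjection

end

/-! ### The likelihood ratio statistic -/

theorem mainTheorem3 {Ω : Type*} [MeasurableSpace Ω] (P : Measure Ω) [IsProbabilityMeasure P]
    {n : ℕ} (K₀ : Submodule ℝ (RVec n)) (K : ProperCone ℝ (RVec n))
    (hsub : (K₀ : Set (RVec n)) ⊆ (K : Set (RVec n)))
    (hne : (K₀ : Set (RVec n)) ≠ (K : Set (RVec n)))
    (μ : RVec n) (hμ : μ ∈ K₀)
    (ξ : Ω → RVec n) (hξ : HasLaw ξ (stdGaussian (RVec n)) P) :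
    0 < statDim (K : Set (RVec n)) - statDim (K₀ : Set (RVec n)) ∧
    0 < lrtSD (K₀ : Set (RVec n)) (K : Set (RVec n)) 0 ∧
    tvDist
        (P.map fun ω =>
          (lrtStat (K₀ : Set (RVec n)) (K : Set (RVec n)) (μ + ξ ω)
              - lrtMean (K₀ : Set (RVec n)) (K : Set (RVec n)) 0)
            / lrtSD (K₀ : Set (RVec n)) (K : Set (RVec n)) 0)
        (gaussianReal 0 1)
      ≤ 8 / √(statDim (K : Set (RVec n)) - statDim (K₀ : Set (RVec n))) := by
  obtain ⟨k, hkK, hkL⟩ := Set.exists_of_ssubset (hsub.ssubset_of_ne hne)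
  have hΦ := isConicProj_residualProj hsub
  have hδ := hΦ.integral_norm_sq_pos (residualProj_ne_zero hkK hkL)
  have hv := hΦ.two_mul_integral_le_variance
  have hmap : P.map (fun ω => (‖residualProj K₀ K (ξ ω)‖ ^ 2
        - ∫ x, ‖residualProj K₀ K x‖ ^ 2 ∂(stdGaussian (RVec n)))
        / √(variance (fun x => ‖residualProj K₀ K x‖ ^ 2) (stdGaussian (RVec n))))
      = (stdGaussian (RVec n)).map fun x => (‖residualProj K₀ K x‖ ^ 2
        - ∫ x, ‖residualProj K₀ K x‖ ^ 2 ∂(stdGaussian (RVec n)))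
        / √(variance (fun x => ‖residualProj K₀ K x‖ ^ 2) (stdGaussian (RVec n))) := by
    rw [← hξ.map_eq, AEMeasurable.map_map_of_aemeasurable _ hξ.aemeasurable]
    · rfl
    · have := hΦ.continuous
      exact Continuous.aemeasurable (by fun_prop)
  simp only [lrtSD, lrtMean, lrtStat_eq hsub, zero_add, residualProj_add hsub hμ,
    statDim_sub_statDim hsub]
  refine ⟨hδ, Real.sqrt_pos.2 (by linarith), ?_⟩
  rw [hmap]
  exact hΦ.tvDist_norm_sq_le hδ
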